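/- **Setting.** An extraction context is a triple $\mathcal K=(\mathcal O,\mathcal I,\mathcal M)$ with $\mathcal O$ (objects) and $\mathcal I$ (items) finite and $\mathcal M\subseteq\mathcal O\times\mathcal I$; $\mathcal I$ is totally ordered. A pattern is a subset of $\mathcal I$. Put $\Phi(O)=\{i:\forall o\in O,\ (o,i)\in\mathcal M\}$, $\Psi(X)=\{o:\forall i\in X,\ (o,i)\in\mathcal M\}$, $\gamma=\Phi\circ\Psi$, $\mathrm{Supp}(X)=|\Psi(X)|$. Let $\mathit{minsupp}\in\mathbb N$ with $\mathit{minsupp}\le|\mathcal O|$ and $\mathit{minconf}\in\mathbb R$. A pattern $X$ is frequent if $\mathrm{Supp}(X)\ge\mathit{minsupp}$ and closed if $\gamma(X)=X$; $\mathcal{IFF}$ is the set of frequent closed patterns. For a pattern $f$, $GM_f$ is the set of inclusion-minimal elements of $[f]=\{g:\gamma(g)=\gamma(f)\}$; $\mathcal{GMF}$ is the set of frequent $g$ with $g\in GM_{\gamma(g)}$. The lower cover $Couv_i(f)$ is the set of $f_1\in\mathcal{IFF}$ with $f_1\subsetneq f$ and no $f_2\in\mathcal{IFF}$ with $f_1\subsetneq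 f_2\subsetneq f$. The generic base of exact rules is $$\mathcal{BG}=\{(g\Rightarrow f\setminus g,\ \mathrm{Supp}(f)) : f\in\mathcal{IFF},\ g\in GM_f,\ g\ne f\},$$ and the transitive reduction of the approximate rules is $$\mathcal{RI}=\{(g\Rightarrow f\setminus g,\ \mathrm{Supp}(f),\ c): f\in\mathcal{IFF},\ g\in\mathcal{GMF},\ \gamma(g)\in Couv_i(f),\ c=\tfrac{\mathrm{Supp}(f)}{\mathrm{Supp}(g)}\ge\mathit{minconf}\}.$$ $\tau(g)$ denotes the set of subsets of $g$ of size $|g|-1$, and $\prec$ the lexicographic order on patterns (written as increasing words). **The algorithm Prince** (input $\mathcal K,\mathit{minsupp},\mathit{minconf}$). *Step 1 (Gen-GMs).* The supports of $\emptyset$ (namely $|\mathcal O|$) and of the singletons are counted. The items of support $|\mathcal O|$ form the set $\emptyset.\mathit{iff}$; of the other singletons, the frequent ones form the level $G_1$ and the others enter the border $B$. Put $G_0=\{\emptyset\}$. For $k=1,2,\dots$, while $G_k\neq\emptyset$: the candidates are the unions of two elements of $G_k$ having $k-1$ items in common, all of whose subsets of size $k$ lie in $G_k$; their supports are counted in the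 context; a candidate whose support differs from the minimum of the supports of its subsets of size $k$ and is at least $\mathit{minsupp}$ enters $G_{k+1}$, and a candidate of support less than $\mathit{minsupp}$ enters $B$. Put $G=\bigcup_k G_k$. The remaining steps do not access the context. *Step 2 (Gen-Ordre).* The support of a pattern $U$ is derived as follows: $U$ is infrequent if it contains an element of $B$, and otherwise its support is the minimum of the supports of the elements of $G$ contained in $U$. Patterns $a,b$ are compared by supports: they are equivalent if $a$, $b$, $a\cup b$ have equal supports, and $a$ is a successor of $b$ if $a$ has smaller support than $b$ and the same support as $a\cup b$. The procedure maintains a list $X$ of representatives (in order of insertion), the recorded class of each representative, and a set of arcs. The elements $g$ of $G$ are treated by decreasing support $n$ and, for equal support, in the order $\prec$. Write $\rho(g_1)$ for the recorded representative of $g_1$, and let $\phi(n,g,g_1)$ be the sublist of those $h\in X$ such that either $h$ has support $n$, is a successor of $\rho(g_1)$, is equivalent to $g$, and $h\prec g$; or $h$ has support $>n$, $h$ is equal to or a successor of $\rho(g_1)$, $g$ is a successor of $h$, and $g$ is a successor of no $h'\in X$ of support $>n$ that is a successor of $h$. For $g_1$ running through $\tau(g)$ in the order $\prec$, the list $\phi(n,g,g_1)$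 is run through in order, its elements of support $>n$ being stored as predecessors; as soon as an element $F$ of support $n$ is met, both runs are suspended. If such an $F$ was met, put $R=F$ and add $g$ to the class of $F$; otherwise put $R=g$, append $g$ to $X$, and let its class be $\{g\}$. Add the arc $(h,R)$ for every stored predecessor $h$. Then, for each element $g_1$ of $\tau(g)$ not yet visited, run through $\phi(n,R,g_1)$, adding the arc $(h,R)$ for each $h$ of support $>n$ and stopping at an element of support $n$. *Step 3 (Gen-BGRs).* All fields $g.\mathit{iff}$ with $g\neq\emptyset$ are initially empty. Start with $L_1=(\emptyset)$, $L_2=()$ and no rules. While $L_1$ is non-empty: for each $g\in L_1$, (i) if $g.\mathit{iff}\ne g$, output the exact rule $t\Rightarrow g.\mathit{iff}\setminus t$, with the support of $g$, for each $t$ in the recorded class of $g$; (ii) for each arc $(g,g_1)$, if $g_1.\mathit{iff}=\emptyset$, let $g_1.\mathit{iff}$ be the union of $g.\mathit{iff}$ and of all elements of the class of $g_1$, and append $g_1$ to $L_2$; then, if the quotient $c$ of the support of $g_1$ by that of $g$ is at least $\mathit{minconf}$, output the approximate rule $t\Rightarrow g_1.\mathit{iff}\setminus t$, with the support of $g_1$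 and confidence $c$, for each $t$ in the class of $g$. Then replace $L_1$ by $L_2$ and $L_2$ by the empty list. At the end, output also, for each representative $R\in X$, the pattern $R.\mathit{iff}$ together with the recorded class of $R$. **Proposition (Prince is valid).** For every finite context $\mathcal K$, every $\mathit{minsupp}\le|\mathcal O|$ and every $\mathit{minconf}$, the algorithm Prince terminates; the set of pairs (pattern, class) that it outputs is exactly $\{(f,GM_f): f\in\mathcal{IFF}\}$, the set of exact rules that it outputs is exactly $\mathcal{BG}$, and the set of approximate rules that it outputs is exactly $\mathcal{RI}$. -/

import Mathlib

namespace Prince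

/-! ### Extraction contexts, closed patterns, minimal generators, generic bases of rules -/

/-- An extraction context: an incidence relation between objects and items (finiteness of the
sets of objects and items is imposed by `Fintype` instances). -/
structure Context (O I : Type*) where
  M : O → I → Prop
  decM : ∀ o i, Decidable (M o i)

attribute [instance] Context.decM

/-- An exact rule `premise ⇒ conclusion` together with its support. -/
@[ext]
structure ExactRule (I : Type*) where
  premise : Finset I
  conclusion : Finset I
  support : ℕ

/-- An approximate rule `premise ⇒ conclusion` together with its support and its confidence. -/
@[ext]
structure ApproxRule (I : Type*) where
  premise : Finset I
  conclusion : Finset I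
  support : ℕ
  confidence : ℝ

section Specification

variable {O I : Type*} [Fintype O] [Fintype I] [DecidableEq I] (K : Context O I)

/-- The items common to all objects of `A`. -/
def Context.Phi (A : Finset O) : Finset I := Finset.univ.filter fun i => ∀ o ∈ A, K.M o i

/-- The objects containing all items of `X`. -/
def Context.Psi (X : Finset I) : Finset O := Finset.univ.filter fun o => ∀ i ∈ X, K.M o i

/-- The Galois closure operator on patterns. -/
def Context.gamma (X : Finset I) : Finset I := K.Phi (K.Psi X)

/-- The absolute support of a pattern. -/
def Context.supp (X : Finset I) : ℕ := (K.Psi X).card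

/-- The minimal generators of `f`: the inclusion-minimal elements of the class
`[f] = {g | γ g = γ f}`. -/
def Context.GM (f : Finset I) : Finset (Finset I) :=
  Finset.univ.filter fun g => K.gamma g = K.gamma f ∧ ∀ g₁, g₁ ⊂ g → K.gamma g₁ ≠ K.gamma f

/-- The frequent closed patterns. -/
def Context.IFF (minsupp : ℕ) : Finset (Finset I) :=
  Finset.univ.filter fun f => K.gamma f = f ∧ minsupp ≤ K.supp f

/-- The frequent minimal generators. -/
def Context.GMF (minsupp : ℕ) : Finset (Finset I) :=
  Finset.univ.filter fun g => g ∈ K.GM (K.gamma g) ∧ minsupp ≤ K.supp g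

/-- The lower cover of `f` in the Iceberg lattice, i.e. in the frequent closed patterns ordered by
inclusion. -/
def Context.lowerCover (minsupp : ℕ) (f : Finset I) : Set (Finset I) :=
  {f₁ | f₁ ∈ K.IFF minsupp ∧ f₁ ⊂ f ∧ ∀ f₂ ∈ K.IFF minsupp, ¬ (f₁ ⊂ f₂ ∧ f₂ ⊂ f)}

/-- The generic base of exact rules. -/
def Context.BG (minsupp : ℕ) : Set (ExactRule I) :=
  {r | ∃ f ∈ K.IFF minsupp, ∃ g ∈ K.GM f, g ≠ f ∧ r = ⟨g, f \ g, K.supp f⟩}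

/-- The transitive reduction of the informative base of approximate rules. -/
def Context.RI (minsupp : ℕ) (minconf : ℝ) : Set (ApproxRule I) :=
  {r | ∃ f ∈ K.IFF minsupp, ∃ g ∈ K.GMF minsupp,
    K.gamma g ∈ K.lowerCover minsupp f ∧ minconf ≤ (K.supp f : ℝ) / (K.supp g : ℝ) ∧
    r = ⟨g, f \ g, K.supp f, (K.supp f : ℝ) / (K.supp g : ℝ)⟩}

end Specification

/-- `while cond do body`, started in `s`; undefined if the loop does not terminate. -/
def whileLoop {σ : Type*} (cond : σ → Bool) (body : σ → σ) (s : σ) : Part σ :=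
  PFun.fix (fun s => Part.some (if cond s then Sum.inr (body s) else Sum.inl s)) s

/-! ### First step: procedures `Gen-GMs` and `Gen-GMs-suivants`

This is the only step that reads the context, through the number of objects and through
`calculSupport`. -/

/-- Variables of `Gen-GMs`: the counter `k`, the level `GMF_k`, the union of the levels found so
far, the negative border, and the field `support` of the patterns counted so far. -/
structure GenState (I : Type*) where
  k : ℕ
  level : Finset (Finset I)
  gmf : Finset (Finset I)
  border : Finset (Finset I)
  support : Finset I → ℕ

/-- Result of the first step. -/
structure GenResult (I : Type*) where
  gmf : Finset (Finset I)
  border : Finset (Finset I)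
  support : Finset I → ℕ
  closureEmpty : Finset I

section StepOne

variable {O I : Type*} [Fintype O] [Fintype I] [DecidableEq I] (K : Context O I)

/-- `Calcul-Support`: one access to the context, filling in the supports of the candidates. -/
def calculSupport (C : Finset (Finset I)) (support : Finset I → ℕ) : Finset I → ℕ :=
  fun c => if c ∈ C then K.supp c else support c

/-- The immediate subsets of `g`, of size `|g| - 1`. -/
def immediateSubsets (g : Finset I) : Finset (Finset I) := g.image fun i => g.erase i

/-- `Apriori-Gen`: joins of two elements of the level `k` having `k - 1` items in common. -/
def aprioriGen (k : ℕ) (L : Finset (Finset I)) : Finset (Finset I) :=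
  ((L ×ˢ L).filter fun p => (p.1 ∩ p.2).card + 1 = k ∧ p.1 ≠ p.2).image fun p => p.1 ∪ p.2

/-- The estimated support of a candidate; `m` is the number of objects. -/
def estimatedSupport (m : ℕ) (support : Finset I → ℕ) (c : Finset I) : ℕ :=
  (immediateSubsets c).fold min m support

/-- `Gen-GMs-suivants`, together with the increment of `k` and the update of the union of the
levels. -/
def genGMsNext (minsupp : ℕ) (s : GenState I) : GenState I :=
  let pre := aprioriGen s.k s.level
  let cgm := pre.filter fun c => ∀ c₁ ∈ immediateSubsets c, c₁ ∈ s.level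
  let sup := calculSupport K cgm s.support
  let next := cgm.filter fun c =>
    sup c ≠ estimatedSupport (Fintype.card O) s.support c ∧ minsupp ≤ sup c
  let rest := cgm.filter fun c =>
    ¬ (sup c ≠ estimatedSupport (Fintype.card O) s.support c ∧ minsupp ≤ sup c) ∧
      sup c < minsupp
  { k := s.k + 1, level := next, gmf := s.gmf ∪ next, border := s.border ∪ rest, support := sup }

/-- The support table after the items have been counted and the empty set has received `|O|`. -/
def itemSupport : Finset I → ℕ :=
  Function.update (calculSupport K (Finset.univ.image fun i : I => {i}) fun _ => 0)
    ∅ (Fintype.card O)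

/-- The state of `Gen-GMs` before its main loop, at `k = 1`. -/
def genGMsInit (minsupp : ℕ) : GenState I :=
  let cgm : Finset (Finset I) := Finset.univ.image fun i : I => {i}
  let level := cgm.filter fun c =>
    itemSupport K c ≠ Fintype.card O ∧ minsupp ≤ itemSupport K c
  let rest := cgm.filter fun c =>
    itemSupport K c ≠ Fintype.card O ∧ ¬ minsupp ≤ itemSupport K c
  { k := 1, level := level, gmf := {∅} ∪ level, border := rest, support := itemSupport K }

/-- `Gen-GMs`. -/
def genGMs (minsupp : ℕ) : Part (GenResult I) :=
  (whileLoop (fun s : GenState I => decide (s.level ≠ ∅)) (genGMsNext K minsupp)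
    (genGMsInit K minsupp)).map fun s =>
      { gmf := s.gmf
        border := s.border
        support := s.support
        closureEmpty := Finset.univ.filter fun i : I => itemSupport K {i} = Fintype.card O }

end StepOne

/-! ### Second step: procedure `Gen-Ordre`

Everything here is computed from the result of the first step, without access to the context. -/

/-- Variables of `Gen-Ordre`: the representatives `X` in their order of insertion, the class
`f R` recorded for each representative `R`, and the recorded arcs `(immediate predecessor,
immediate successor)`. -/
structure OrdreState (I : Type*) where
  X : List (Finset I)
  f : Finset I → List (Finset I)
  lattice : List (Finset I × Finset I)

section StepTwo

variable {I : Type*} [LinearOrder I]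

/-- The word of `g`: its items in increasing order. -/
def word (g : Finset I) : List I := g.sort (· ≤ ·)

/-- Strict lexicographic order on patterns. -/
def lexLT (g h : Finset I) : Prop := word g < word h

instance (g h : Finset I) : Decidable (lexLT g h) :=
  inferInstanceAs (Decidable (word g < word h))

/-- The elements of a family of patterns in lexicographic order. -/
def lexList (G : Finset (Finset I)) : List (Finset I) :=
  ((G.image word).sort (· ≤ ·)).map List.toFinset

/-- The immediate subsets of `g` in lexicographic order. -/
def tau (g : Finset I) : List (Finset I) := lexList (immediateSubsets g)

variable (S : GenResult I)

/-- The support of an arbitrary pattern, derived from the frequent minimal generators and the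
negative border; `none` means that the pattern is infrequent. -/
def derivedSupport (U : Finset I) : Option ℕ :=
  if ∃ Z ∈ S.border, Z ⊆ U then none
  else some ((S.gmf.filter fun g => g ⊆ U).fold min (S.support ∅) S.support)

/-- Comparison of supports: `a` and `b` are in the same class. -/
def Equiv (a b : Finset I) : Prop :=
  S.support a = S.support b ∧ derivedSupport S (a ∪ b) = some (S.support a)

/-- Comparison of supports: the class of `a` is a successor of the class of `b`. -/
def Succ (a b : Finset I) : Prop :=
  S.support a < S.support b ∧ derivedSupport S (a ∪ b) = some (S.support a)

instance (a b : Finset I) : Decidable (Equiv S a b) :=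
  inferInstanceAs (Decidable (_ ∧ _))

instance (a b : Finset I) : Decidable (Succ S a b) :=
  inferInstanceAs (Decidable (_ ∧ _))

/-- The recorded representative of the class of `g`. -/
def OrdreState.rep (s : OrdreState I) (g : Finset I) : Finset I :=
  (s.X.find? fun R => decide (g ∈ s.f R)).getD g

/-- The set `φ(n, g, g₁)` of representatives, in their order of insertion. -/
def phi (s : OrdreState I) (n : ℕ) (g g₁ : Finset I) : List (Finset I) :=
  s.X.filter fun h => decide
    ((S.support h = n ∧ Succ S h (s.rep g₁) ∧ Equiv S h g ∧ lexLT h g) ∨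
     (n < S.support h ∧ (h = s.rep g₁ ∨ Succ S h (s.rep g₁)) ∧ Succ S g h ∧
       ∀ h' ∈ s.X, n < S.support h' → Succ S h' h → ¬ Succ S g h'))

/-- Blocks D and G: run through a list `φ`, adding the elements of support `> n` to `pred`; stop at
an element of support `n` and return it. -/
def scan (n : ℕ) : List (Finset I) → List (Finset I) → List (Finset I) × Option (Finset I)
  | [], pred => (pred, none)
  | F :: l, pred => if n < S.support F then scan n l (pred ++ [F]) else (pred, some F)

/-- Block C: run through the immediate subsets of `g` until the representative of `g` is met.
Returns the predecessors found, the representative if it was met, and the immediate subsets that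
remain to be treated. -/
def blockC (s : OrdreState I) (n : ℕ) (g : Finset I) :
    List (Finset I) → List (Finset I) →
      List (Finset I) × Option (Finset I) × List (Finset I)
  | [], pred => (pred, none, [])
  | g₁ :: l, pred =>
    match scan S n (phi S s n g g₁) pred with
    | (pred', some F) => (pred', some F, l)
    | (pred', none) => blockC s n g l pred'

/-- Block E: `g` joins the class of the representative that was met, or else becomes the
representative of a new class. Returns the new state and the representative of `g`. -/
def blockE (s : OrdreState I) (g : Finset I) : Option (Finset I) → OrdreState I × Finset I
  | some F => ({ s with f := Function.update s.f F (s.f F ++ [g]) }, F)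
  | none => ({ s with X := s.X ++ [g], f := Function.update s.f g [g] }, g)

/-- One iteration of block F: the immediate subset `g₁` is treated with the representative `R`. -/
def blockF (n : ℕ) (R : Finset I) (s : OrdreState I) (g₁ : Finset I) : OrdreState I :=
  { s with lattice := s.lattice ++ (scan S n (phi S s n R g₁) []).1.map fun F => (F, R) }

/-- Treatment of one frequent minimal generator `g` of support `n` (body of loop B). -/
def insertGen (n : ℕ) (s : OrdreState I) (g : Finset I) : OrdreState I :=
  let c := blockC S s n g (tau g) []
  let e := blockE s g c.2.1
  let s' : OrdreState I :=
    { e.1 with lattice := e.1.lattice ++ c.1.map fun F => (F, e.2) }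
  c.2.2.foldl (blockF S n e.2) s'

/-- `Gen-Ordre`: the supports in decreasing order (loop A), and for each support the frequent
minimal generators in lexicographic order (loop B). -/
def genOrdre : OrdreState I :=
  ((S.gmf.image S.support).sort (· ≥ ·)).foldl
    (fun s n => (lexList (S.gmf.filter fun g => S.support g = n)).foldl (insertGen S n) s)
    { X := [], f := fun _ => [], lattice := [] }

/-- The field `succs-immédiats` of a representative. -/
def OrdreState.succs (T : OrdreState I) (g : Finset I) : List (Finset I) :=
  T.X.filter fun h => decide ((g, h) ∈ T.lattice)

end StepTwo

/-! ### Third step: procedure `Gen-BGRs` -/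

/-- Variables of `Gen-BGRs`. -/
structure BGRState (I : Type*) where
  BG : List (ExactRule I)
  RI : List (ApproxRule I)
  L₁ : List (Finset I)
  L₂ : List (Finset I)
  iff : Finset I → Finset I

/-- Output of the algorithm: the frequent closed patterns, each one with the set of its minimal
generators, the exact rules and the approximate rules. -/
structure Output (I : Type*) where
  closed : List (Finset I × Finset (Finset I))
  BG : List (ExactRule I)
  RI : List (ApproxRule I)

section StepThree

variable {I : Type*} [LinearOrder I]

/-- Treatment of one immediate successor `g₁` of `g`. -/
noncomputable def visitSucc (S : GenResult I) (T : OrdreState I) (minconf : ℝ) (g : Finset I)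
    (s : BGRState I) (g₁ : Finset I) : BGRState I :=
  let s₁ : BGRState I :=
    if s.iff g₁ = ∅ then
      { s with
        iff := Function.update s.iff g₁ ((T.f g₁).foldl (fun a t => a ∪ t) ∅ ∪ s.iff g)
        L₂ := s.L₂ ++ [g₁] }
    else s
  let conf : ℝ := (S.support g₁ : ℝ) / (S.support g : ℝ)
  if minconf ≤ conf then
    { s₁ with
      RI := s₁.RI ++ (T.f g).map fun t => ⟨t, s₁.iff g₁ \ t, S.support g₁, conf⟩ }
  else s₁

/-- Treatment of one class, given by its representative `g`. -/
noncomputable def visitClass (S : GenResult I) (T : OrdreState I) (minconf : ℝ)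
    (s : BGRState I) (g : Finset I) : BGRState I :=
  let s₁ : BGRState I :=
    if s.iff g ≠ g then
      { s with BG := s.BG ++ (T.f g).map fun t => ⟨t, s.iff g \ t, S.support g⟩ }
    else s
  (T.succs g).foldl (visitSucc S T minconf g) s₁

/-- Body of the main loop: treat all classes of `L₁`, then let `L₁ = L₂` and `L₂ = ∅`. -/
noncomputable def bgrStep (S : GenResult I) (T : OrdreState I) (minconf : ℝ)
    (s : BGRState I) : BGRState I :=
  let s₁ := s.L₁.foldl (visitClass S T minconf) s
  { s₁ with L₁ := s₁.L₂, L₂ := [] }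

/-- `Gen-BGRs`. -/
noncomputable def genBGRs (S : GenResult I) (T : OrdreState I) (minconf : ℝ) :
    Part (Output I) :=
  (whileLoop (fun s : BGRState I => decide (s.L₁ ≠ [])) (bgrStep S T minconf)
    { BG := []
      RI := []
      L₁ := [∅]
      L₂ := []
      iff := Function.update (fun _ => ∅) ∅ S.closureEmpty }).map fun s =>
        { closed := T.X.map fun R => (s.iff R, (T.f R).toFinset)
          BG := s.BG
          RI := s.RI }

end StepThree

/-- The algorithm `Prince`: a partial value, defined when the loops terminate. -/
noncomputable def prince {O I : Type*} [Fintype O] [Fintype I] [LinearOrder I] (K : Context O I)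
    (minsupp : ℕ) (minconf : ℝ) : Part (Output I) :=
  (genGMs K minsupp).bind fun S => genBGRs S (genOrdre S) minconf

end Prince

/-!
The algorithm never sees closures; it sees only the frequent minimal generators, their supports
and the negative border. Three facts make this enough.

* Minimal generators form an order ideal (`IsGen.subset`), and a minimal infrequent pattern is
  itself a minimal generator. Hence the levelwise search of `Gen-GMs` meets every frequent minimal
  generator and every minimal infrequent pattern (`GenInv.next`). Since every pattern contains a
  minimal generator of its closure, the support of an arbitrary pattern can be read off
  (`GenCorrect.derivedSupport_eq`), and the comparisons by supports decide equality and inclusion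
  of closures (`GenCorrect.equiv_iff`, `GenCorrect.succ_iff`).

* If `h` is an immediate predecessor of the frequent closed pattern `f` and `i ∈ f \ h`, then the
  closure of `h ∪ {i}` is `f`; so `f` has a minimal generator `g` with `i ∈ g` and
  `g \ {i} ⊆ h` (`exists_generator_of_lowerCover`). By decreasing support, all classes above `n`
  are known when a generator of support `n` is treated, so that `φ(n, g, g₁)` consists of the
  representative of the class of `g`, if it exists already, and of those immediate predecessors of
  this class that lie above the class of `g₁` (`ClassInv.mem_phi`). All recorded arcs are therefore
  covers, and the generator just described guarantees that every cover is recorded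
  (`ordreCorrect_genOrdre`).

* By the same lemma, `f` is the union of any one of its immediate predecessors and of all its
  minimal generators, which is how `Gen-BGRs` computes closures (`Visits.visitSucc`). Every class is
  reached from that of the empty set by a chain of covers, and the closed patterns still to be
  treated after `k` iterations have at least `k` items, which gives termination
  (`exists_mem_genBGRs`).
-/

namespace Prince

/-! ### The Galois connection, minimal generators and covers -/

section Specification

variable {O I : Type*} [Fintype O] [Fintype I] [DecidableEq I] {K : Context O I}
  {X Y f g h : Finset I} {minsupp : ℕ}

theorem mem_Psi {o : O} : o ∈ K.Psi X ↔ ∀ i ∈ X, K.M o i := by simp [Context.Psi]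

theorem mem_gamma {i : I} : i ∈ K.gamma X ↔ ∀ o ∈ K.Psi X, K.M o i := by
  simp [Context.gamma, Context.Phi]

theorem Psi_anti (hXY : X ⊆ Y) : K.Psi Y ⊆ K.Psi X := fun _ ho =>
  mem_Psi.2 fun i hi => mem_Psi.1 ho i (hXY hi)

theorem subset_gamma : X ⊆ K.gamma X := fun i hi => mem_gamma.2 fun _ ho => mem_Psi.1 ho i hi

theorem Psi_gamma : K.Psi (K.gamma X) = K.Psi X :=
  (Psi_anti subset_gamma).antisymm fun o ho => mem_Psi.2 fun _ hi => mem_gamma.1 hi o ho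

theorem gamma_mono (hXY : X ⊆ Y) : K.gamma X ⊆ K.gamma Y := fun _ hi =>
  mem_gamma.2 fun o ho => mem_gamma.1 hi o (Psi_anti hXY ho)

@[simp] theorem gamma_gamma : K.gamma (K.gamma X) = K.gamma X := by
  rw [Context.gamma, Psi_gamma, Context.gamma]

@[simp] theorem supp_gamma : K.supp (K.gamma X) = K.supp X := by
  rw [Context.supp, Psi_gamma, Context.supp]

theorem supp_empty : K.supp ∅ = Fintype.card O := by
  simp [Context.supp, Context.Psi]

theorem supp_anti (hXY : X ⊆ Y) : K.supp Y ≤ K.supp X := Finset.card_le_card (Psi_anti hXY)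

theorem supp_eq_of_gamma_eq (hXY : K.gamma X = K.gamma Y) : K.supp X = K.supp Y := by
  rw [← supp_gamma (X := X), hXY, supp_gamma]

theorem gamma_eq_of_subset_of_supp_le (hXY : X ⊆ Y) (hs : K.supp X ≤ K.supp Y) :
    K.gamma X = K.gamma Y := by
  rw [Context.gamma, Context.gamma, Finset.eq_of_subset_of_card_le (Psi_anti hXY) hs]

theorem gamma_subset_gamma_iff : K.gamma Y ⊆ K.gamma X ↔ Y ⊆ K.gamma X :=
  ⟨subset_gamma.trans, fun hY => by simpa using gamma_mono (K := K) hY⟩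

/-- Comparing supports decides inclusion of closures. -/
theorem supp_union_eq_iff : K.supp (X ∪ Y) = K.supp X ↔ K.gamma Y ⊆ K.gamma X := by
  constructor
  · intro hs
    rw [gamma_eq_of_subset_of_supp_le (Finset.subset_union_left (s₂ := Y)) hs.ge]
    exact gamma_mono Finset.subset_union_right
  · intro hY
    refine (supp_anti Finset.subset_union_left).antisymm ?_
    rw [← supp_gamma (X := X)]
    exact supp_anti (Finset.union_subset subset_gamma (gamma_subset_gamma_iff.1 hY))

theorem gamma_eq_of_subset_gamma_of_supp_le (hXY : K.gamma X ⊆ K.gamma Y)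
    (hs : K.supp X ≤ K.supp Y) : K.gamma X = K.gamma Y := by
  rw [← gamma_gamma (X := X), ← gamma_gamma (X := Y)]
  exact gamma_eq_of_subset_of_supp_le hXY (by rwa [supp_gamma, supp_gamma])

theorem supp_lt_of_gamma_ssubset (hXY : K.gamma X ⊂ K.gamma Y) : K.supp Y < K.supp X := by
  by_contra! hs
  exact hXY.ne (gamma_eq_of_subset_gamma_of_supp_le hXY.subset hs)

/-- `g` is a minimal generator of its own closure. -/
def IsGen (K : Context O I) (g : Finset I) : Prop := ∀ g₁, g₁ ⊂ g → K.gamma g₁ ≠ K.gamma g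

theorem mem_GM : g ∈ K.GM f ↔ K.gamma g = K.gamma f ∧ IsGen K g := by
  simp only [Context.GM, Finset.mem_filter, Finset.mem_univ, true_and, IsGen]
  exact and_congr_right fun hg => by rw [hg]

theorem mem_GMF : g ∈ K.GMF minsupp ↔ IsGen K g ∧ minsupp ≤ K.supp g := by
  simp [Context.GMF, mem_GM]

theorem mem_IFF : f ∈ K.IFF minsupp ↔ K.gamma f = f ∧ minsupp ≤ K.supp f := by
  simp [Context.IFF]

theorem gamma_mem_IFF : K.gamma g ∈ K.IFF minsupp ↔ minsupp ≤ K.supp g := by simp [mem_IFF]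

theorem mem_GM_iff_of_mem_IFF (hf : f ∈ K.IFF minsupp) :
    g ∈ K.GM f ↔ g ∈ K.GMF minsupp ∧ K.gamma g = f := by
  rw [mem_IFF] at hf
  rw [mem_GM, mem_GMF, hf.1]
  constructor
  · rintro ⟨h1, h2⟩
    refine ⟨⟨h2, ?_⟩, h1⟩
    rw [← supp_gamma, h1]
    exact hf.2
  · rintro ⟨h1, h2⟩
    exact ⟨h2, h1.1⟩

theorem isGen_empty : IsGen K ∅ := fun _ hg => absurd hg (Finset.not_ssubset_empty _)

theorem isGen_iff : IsGen K g ↔ ∀ i ∈ g, K.supp (g.erase i) ≠ K.supp g := by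
  constructor
  · intro hg i hi hs
    exact hg _ (Finset.erase_ssubset hi)
      (gamma_eq_of_subset_of_supp_le (Finset.erase_subset _ _) hs.le)
  · intro hg g₁ hlt he
    obtain ⟨i, hi, hi₁⟩ := Finset.exists_of_ssubset hlt
    refine hg i hi (le_antisymm ?_ (supp_anti (Finset.erase_subset _ _)))
    rw [← supp_eq_of_gamma_eq he]
    exact supp_anti (Finset.subset_erase.2 ⟨hlt.subset, hi₁⟩)

/-- Minimal generators form an order ideal: if removing `i` from a subset does not change its
support, then removing `i` from the larger set does not either. -/
theorem IsGen.subset (hg : IsGen K g) (hhg : h ⊆ g) : IsGen K h := by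
  rw [isGen_iff] at hg ⊢
  intro i hi hs
  refine hg i (hhg hi) (le_antisymm ?_ (supp_anti (Finset.erase_subset _ _)))
  have hc := gamma_eq_of_subset_of_supp_le (K := K) (Finset.erase_subset i h) hs.le
  have hi' : i ∈ K.gamma (g.erase i) := by
    refine gamma_mono (Finset.erase_subset_erase i hhg) ?_
    rw [hc]
    exact subset_gamma hi
  rw [← supp_gamma (X := g.erase i)]
  refine supp_anti fun j hj => ?_
  by_cases hji : j = i
  · rwa [hji]
  · exact subset_gamma (Finset.mem_erase.2 ⟨hji, hj⟩)

theorem mem_GMF_of_subset (hg : g ∈ K.GMF minsupp) (hhg : h ⊆ g) : h ∈ K.GMF minsupp := by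
  rw [mem_GMF] at *
  exact ⟨hg.1.subset hhg, hg.2.trans (supp_anti hhg)⟩

theorem exists_isGen_subset (U : Finset I) : ∃ g ⊆ U, IsGen K g ∧ K.gamma g = K.gamma U := by
  induction U using Finset.strongInduction with
  | H U ih =>
    by_cases hU : IsGen K U
    · exact ⟨U, subset_rfl, hU, rfl⟩
    · simp only [IsGen, not_forall, not_not] at hU
      obtain ⟨V, hV, he⟩ := hU
      obtain ⟨g, hg, hgen, hc⟩ := ih V hV
      exact ⟨g, hg.trans hV.subset, hgen, hc.trans he⟩

theorem exists_mem_GMF_subset (U : Finset I) (hU : minsupp ≤ K.supp U) :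
    ∃ g ⊆ U, g ∈ K.GMF minsupp ∧ K.gamma g = K.gamma U := by
  obtain ⟨g, hg, hgen, hc⟩ := exists_isGen_subset (K := K) U
  exact ⟨g, hg, mem_GMF.2 ⟨hgen, hU.trans (supp_eq_of_gamma_eq hc).ge⟩, hc⟩

theorem IsGen.gamma_erase_ssubset (hg : IsGen K g) {i : I} (hi : i ∈ g) :
    K.gamma (g.erase i) ⊂ K.gamma g :=
  (gamma_mono (Finset.erase_subset _ _)).ssubset_of_ne (hg _ (Finset.erase_ssubset hi))

/-- Every element of a frequent closed pattern `f` outside an immediate predecessor `h` of `f`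
belongs to a minimal generator of `f` which has no other element outside `h`: the closure of
`h ∪ {i}` lies strictly above `h` and hence is `f`. -/
theorem exists_generator_of_lowerCover (hf : f ∈ K.IFF minsupp)
    (hh : h ∈ K.lowerCover minsupp f) {i : I} (hi : i ∈ f) (hih : i ∉ h) :
    ∃ g ∈ K.GMF minsupp, K.gamma g = f ∧ i ∈ g ∧ g.erase i ⊆ h := by
  obtain ⟨hh1, hh2, hh3⟩ := hh
  have hf' := mem_IFF.1 hf
  have hle : K.gamma (insert i h) ⊆ f := by
    rw [← hf'.1]
    exact gamma_mono (Finset.insert_subset hi hh2.subset)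
  have hsupp : minsupp ≤ K.supp (insert i h) := by
    rw [← supp_gamma]
    exact hf'.2.trans (supp_anti hle)
  have hgt : h ⊂ K.gamma (insert i h) :=
    (Finset.ssubset_insert hih).trans_subset subset_gamma
  have heq : K.gamma (insert i h) = f := by
    by_contra hne
    exact hh3 _ (gamma_mem_IFF.2 hsupp) ⟨hgt, hle.ssubset_of_ne hne⟩
  obtain ⟨g, hg, hgm, hgc⟩ := exists_mem_GMF_subset _ hsupp
  refine ⟨g, hgm, hgc.trans heq, ?_, fun j hj => ?_⟩
  · by_contra hig
    have hgh : g ⊆ h := (Finset.subset_insert_iff_of_notMem hig).1 hg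
    have := gamma_mono (K := K) hgh
    rw [(mem_IFF.1 hh1).1, hgc, heq] at this
    exact hh2.not_subset this
  · obtain ⟨hji, hj⟩ := Finset.mem_erase.1 hj
    exact (Finset.mem_insert.1 (hg hj)).resolve_left hji

/-- Below every frequent closed pattern other than the closure of the empty set there is an
immediate predecessor. -/
theorem exists_mem_lowerCover (hf : f ∈ K.IFF minsupp) (hne : f ≠ K.gamma ∅) :
    ∃ h, h ∈ K.lowerCover minsupp f := by
  have hf' := mem_IFF.1 hf
  have hlt : K.gamma ∅ ⊂ f := by
    refine LE.le.ssubset_of_ne ?_ hne.symm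
    rw [← hf'.1]
    exact gamma_mono (Finset.empty_subset _)
  have hmem : K.gamma ∅ ∈ (K.IFF minsupp).filter (· ⊂ f) := by
    simp only [Finset.mem_filter, hlt, and_true, gamma_mem_IFF]
    exact hf'.2.trans (supp_anti (Finset.empty_subset _))
  obtain ⟨h, hh⟩ := Finset.exists_maximal ⟨_, hmem⟩
  obtain ⟨hh1, hh2⟩ := Finset.mem_filter.1 hh.prop
  exact ⟨h, hh1, hh2, fun f₂ hf₂ hlt₂ =>
    hlt₂.1.not_subset (hh.le_of_ge (Finset.mem_filter.2 ⟨hf₂, hlt₂.2⟩) hlt₂.1.subset)⟩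

end Specification

/-! ### Termination and partial correctness of loops -/

/-- A loop terminates in a state satisfying its invariant `P` (in which the number of iterations
may occur) if the invariant bounds the number of iterations. -/
theorem exists_mem_whileLoop {σ : Type*} {cond : σ → Bool} {body : σ → σ} (P : ℕ → σ → Prop)
    (N : ℕ) (hstep : ∀ k s, P k s → cond s = true → P (k + 1) (body s))
    (hbound : ∀ k s, P k s → cond s = true → k < N) {s : σ} (h0 : P 0 s) :
    ∃ s' ∈ whileLoop cond body s, ∃ k, P k s' ∧ cond s' = false := by
  suffices H : ∀ m k s, N - k = m → P k s →
      ∃ s' ∈ whileLoop cond body s, ∃ k, P k s' ∧ cond s' = false from H _ 0 s rfl h0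
  intro m
  induction m with
  | zero =>
    intro k s hk hP
    have hc : cond s = false := by
      by_contra hc
      have := hbound k s hP (by simpa using hc)
      omega
    exact ⟨s, PFun.mem_fix_iff.2 (Or.inl (by simp [hc])), k, hP, hc⟩
  | succ m ih =>
    intro k s hk hP
    cases hc : cond s with
    | false => exact ⟨s, PFun.mem_fix_iff.2 (Or.inl (by simp [hc])), k, hP, hc⟩
    | true =>
      obtain ⟨s', hs', hres⟩ := ih (k + 1) (body s) (by omega) (hstep k s hP hc)
      exact ⟨s', PFun.mem_fix_iff.2 (Or.inr ⟨body s, by simp [hc], hs'⟩), hres⟩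

/-! ### Frequent minimal generators and negative border -/

theorem mem_immediateSubsets {I : Type*} [DecidableEq I] {g h : Finset I} :
    h ∈ immediateSubsets g ↔ ∃ i ∈ g, g.erase i = h := by simp [immediateSubsets]

section StepOne

variable {O I : Type*} [Fintype O] [Fintype I] [DecidableEq I] {K : Context O I} {minsupp : ℕ}

theorem itemSupport_empty : itemSupport K ∅ = Fintype.card O := by simp [itemSupport]

theorem itemSupport_singleton (i : I) : itemSupport K {i} = K.supp {i} := by
  simp [itemSupport, calculSupport]

theorem supp_le_card (X : Finset I) : K.supp X ≤ Fintype.card O :=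
  supp_empty (K := K) ▸ supp_anti (Finset.empty_subset X)

theorem isGen_singleton {i : I} : IsGen K {i} ↔ K.supp {i} ≠ Fintype.card O := by
  simp [isGen_iff, supp_empty, eq_comm]

/-- The invariant of `Gen-GMs`: all levels up to `s.k` are known, and so are the elements of the
negative border up to this size. -/
structure GenInv (K : Context O I) (minsupp : ℕ) (s : GenState I) : Prop where
  one_le : 1 ≤ s.k
  mem_level : ∀ g, g ∈ s.level ↔ g ∈ K.GMF minsupp ∧ g.card = s.k
  mem_gmf : ∀ g, g ∈ s.gmf ↔ g ∈ K.GMF minsupp ∧ g.card ≤ s.k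
  supp_lt_of_mem_border : ∀ Z ∈ s.border, K.supp Z < minsupp
  mem_border : ∀ Z : Finset I, Z.card ≤ s.k → K.supp Z < minsupp →
    (∀ i ∈ Z, minsupp ≤ K.supp (Z.erase i)) → Z ∈ s.border
  support_eq : ∀ g ∈ s.gmf, s.support g = K.supp g

theorem genInv_init (hminsupp : minsupp ≤ Fintype.card O) :
    GenInv K minsupp (genGMsInit K minsupp) := by
  have hlevel : ∀ g, g ∈ (genGMsInit K minsupp).level ↔ g ∈ K.GMF minsupp ∧ g.card = 1 := by
    intro g
    simp only [genGMsInit, Finset.mem_filter, Finset.mem_image, Finset.mem_univ, true_and]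
    constructor
    · rintro ⟨⟨i, rfl⟩, h1, h2⟩
      rw [itemSupport_singleton] at h1 h2
      exact ⟨mem_GMF.2 ⟨isGen_singleton.2 h1, h2⟩, Finset.card_singleton i⟩
    · rintro ⟨h1, h2⟩
      obtain ⟨i, rfl⟩ := Finset.card_eq_one.1 h2
      rw [mem_GMF, isGen_singleton] at h1
      rw [itemSupport_singleton]
      exact ⟨⟨i, rfl⟩, h1⟩
  have hgmf : ∀ g, g ∈ (genGMsInit K minsupp).gmf ↔
      g = ∅ ∨ g ∈ (genGMsInit K minsupp).level := by
    intro g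
    simp [genGMsInit]
  have hempty : ∅ ∈ K.GMF minsupp := mem_GMF.2 ⟨isGen_empty, by rwa [supp_empty]⟩
  refine ⟨le_rfl, hlevel, fun g => ?_, fun Z hZ => ?_, fun Z hZ hs hi => ?_, fun g hg => ?_⟩
  · rw [hgmf, hlevel]
    change _ ↔ _ ∧ g.card ≤ 1
    constructor
    · rintro (rfl | h)
      · exact ⟨hempty, by simp⟩
      · exact ⟨h.1, h.2.le⟩
    · rintro ⟨h1, h2⟩
      rcases Nat.le_one_iff_eq_zero_or_eq_one.1 h2 with h | h
      · exact Or.inl (Finset.card_eq_zero.1 h)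
      · exact Or.inr ⟨h1, h⟩
  · simp only [genGMsInit, Finset.mem_filter, Finset.mem_image, Finset.mem_univ, true_and] at hZ
    obtain ⟨⟨i, rfl⟩, -, h2⟩ := hZ
    rw [itemSupport_singleton] at h2
    omega
  · rcases Nat.le_one_iff_eq_zero_or_eq_one.1 hZ with h | h
    · rw [Finset.card_eq_zero.1 h, supp_empty] at hs
      omega
    · obtain ⟨i, rfl⟩ := Finset.card_eq_one.1 h
      simp only [genGMsInit, Finset.mem_filter, Finset.mem_image, Finset.mem_univ, true_and]
      rw [itemSupport_singleton]
      exact ⟨⟨i, rfl⟩, by omega, by omega⟩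
  · change itemSupport K g = _
    rcases (hgmf g).1 hg with rfl | h
    · rw [itemSupport_empty, supp_empty]
    · obtain ⟨i, rfl⟩ := Finset.card_eq_one.1 ((hlevel g).1 h).2
      exact itemSupport_singleton i

/-- The candidates of size `s.k + 1`. -/
def candidates (s : GenState I) : Finset (Finset I) :=
  (aprioriGen s.k s.level).filter fun c => ∀ c₁ ∈ immediateSubsets c, c₁ ∈ s.level

theorem GenInv.mem_candidates {s : GenState I} (H : GenInv K minsupp s) {c : Finset I} :
    c ∈ candidates s ↔ c.card = s.k + 1 ∧ ∀ i ∈ c, c.erase i ∈ s.level := by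
  simp only [candidates, Finset.mem_filter, mem_immediateSubsets, forall_exists_index, and_imp,
    forall_apply_eq_imp_iff₂]
  refine and_congr_left fun hc => ?_
  simp only [aprioriGen, Finset.mem_image, Finset.mem_filter, Finset.mem_product, Prod.exists]
  constructor
  · rintro ⟨p, q, ⟨⟨hp, hq⟩, hpq, -⟩, rfl⟩
    have h1 := ((H.mem_level p).1 hp).2
    have h2 := ((H.mem_level q).1 hq).2
    have := Finset.card_union_add_card_inter p q
    omega
  · intro hcard
    have hk := H.one_le
    obtain ⟨a, ha, b, hb, hab⟩ := Finset.one_lt_card.1 (show 1 < c.card by omega)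
    refine ⟨c.erase a, c.erase b, ⟨⟨hc a ha, hc b hb⟩, ?_, fun h => ?_⟩, ?_⟩
    · have : c.erase a ∩ c.erase b = (c.erase a).erase b := by
        ext x
        simp only [Finset.mem_inter, Finset.mem_erase]
        tauto
      rw [this, Finset.card_erase_of_mem (Finset.mem_erase.2 ⟨hab.symm, hb⟩),
        Finset.card_erase_of_mem ha]
      omega
    · have : a ∈ c.erase a := h ▸ Finset.mem_erase.2 ⟨hab, ha⟩
      simp at this
    · ext x
      simp only [Finset.mem_union, Finset.mem_erase]
      constructor
      · tauto
      · intro hx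
        by_cases hxa : x = a
        · exact Or.inr ⟨hxa ▸ hab, hx⟩
        · exact Or.inl ⟨hxa, hx⟩

/-- The test on the estimated support decides whether a candidate is a minimal generator. -/
theorem supp_ne_estimatedSupport_iff {c : Finset I} (hc : c.Nonempty) {sup : Finset I → ℕ}
    (hsup : ∀ i ∈ c, sup (c.erase i) = K.supp (c.erase i)) :
    K.supp c ≠ estimatedSupport (Fintype.card O) sup c ↔ IsGen K c := by
  have hle : K.supp c ≤ estimatedSupport (Fintype.card O) sup c := by
    rw [estimatedSupport, Finset.le_fold_min]
    refine ⟨supp_le_card c, fun x hx => ?_⟩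
    obtain ⟨i, hi, rfl⟩ := mem_immediateSubsets.1 hx
    rw [hsup i hi]
    exact supp_anti (Finset.erase_subset _ _)
  rw [isGen_iff, ← not_iff_not]
  push Not
  constructor
  · intro h
    have h' : estimatedSupport (Fintype.card O) sup c ≤ K.supp c := h.ge
    rw [estimatedSupport, Finset.fold_min_le] at h'
    rcases h' with h' | ⟨x, hx, hxs⟩
    · obtain ⟨i, hi⟩ := hc
      exact ⟨i, hi, ((supp_le_card _).trans h').antisymm (supp_anti (Finset.erase_subset _ _))⟩
    · obtain ⟨i, hi, rfl⟩ := mem_immediateSubsets.1 hx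
      rw [hsup i hi] at hxs
      exact ⟨i, hi, hxs.antisymm (supp_anti (Finset.erase_subset _ _))⟩
  · rintro ⟨i, hi, his⟩
    refine hle.antisymm ?_
    rw [estimatedSupport, Finset.fold_min_le]
    exact Or.inr ⟨_, mem_immediateSubsets.2 ⟨i, hi, rfl⟩, by rw [hsup i hi, his]⟩

theorem GenInv.next {s : GenState I} (H : GenInv K minsupp s) :
    GenInv K minsupp (genGMsNext K minsupp s) := by
  have hsup : ∀ c ∈ candidates s, calculSupport K (candidates s) s.support c = K.supp c := by
    intro c hc
    simp [calculSupport, hc]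
  have hlevel_gmf : ∀ g ∈ s.level, g ∈ s.gmf := fun g hg =>
    (H.mem_gmf g).2 ⟨((H.mem_level g).1 hg).1, ((H.mem_level g).1 hg).2.le⟩
  have hgen : ∀ c ∈ candidates s,
      (K.supp c ≠ estimatedSupport (Fintype.card O) s.support c ↔ IsGen K c) := by
    intro c hc
    obtain ⟨h1, h2⟩ := H.mem_candidates.1 hc
    exact supp_ne_estimatedSupport_iff (Finset.card_pos.1 (by omega)) fun i hi =>
      H.support_eq _ (hlevel_gmf _ (h2 i hi))
  have hcand : ∀ c : Finset I, c.card = s.k + 1 → (∀ i ∈ c, c.erase i ∈ K.GMF minsupp) →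
      c ∈ candidates s := by
    intro c hc h
    refine H.mem_candidates.2 ⟨hc, fun i hi => (H.mem_level _).2 ⟨h i hi, ?_⟩⟩
    rw [Finset.card_erase_of_mem hi]
    omega
  have hlevel : ∀ g, g ∈ (genGMsNext K minsupp s).level ↔
      g ∈ K.GMF minsupp ∧ g.card = s.k + 1 := by
    intro g
    change g ∈ (candidates s).filter (fun c => calculSupport K (candidates s) s.support c ≠
      estimatedSupport (Fintype.card O) s.support c ∧
        minsupp ≤ calculSupport K (candidates s) s.support c) ↔ _
    rw [Finset.mem_filter]
    constructor
    · rintro ⟨hc, h1, h2⟩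
      rw [hsup g hc] at h1 h2
      exact ⟨mem_GMF.2 ⟨(hgen g hc).1 h1, h2⟩, (H.mem_candidates.1 hc).1⟩
    · rintro ⟨hg, hc⟩
      have hc' := hcand g hc fun i _ => mem_GMF_of_subset hg (Finset.erase_subset _ _)
      rw [hsup g hc', hgen g hc']
      exact ⟨hc', mem_GMF.1 hg⟩
  have hgmf : ∀ g, g ∈ (genGMsNext K minsupp s).gmf ↔
      g ∈ s.gmf ∨ g ∈ (genGMsNext K minsupp s).level := fun g => Finset.mem_union
  have hborder : ∀ Z, Z ∈ (genGMsNext K minsupp s).border ↔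
      Z ∈ s.border ∨ Z ∈ candidates s ∧ K.supp Z < minsupp := by
    intro Z
    change Z ∈ s.border ∪ (candidates s).filter (fun c =>
      ¬ (calculSupport K (candidates s) s.support c ≠
        estimatedSupport (Fintype.card O) s.support c ∧
          minsupp ≤ calculSupport K (candidates s) s.support c) ∧
        calculSupport K (candidates s) s.support c < minsupp) ↔ _
    rw [Finset.mem_union, Finset.mem_filter]
    refine or_congr_right (and_congr_right fun hZ => ?_)
    rw [hsup Z hZ]
    exact ⟨fun h => h.2, fun h => ⟨fun h' => h.not_ge h'.2, h⟩⟩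
  refine ⟨Nat.le_add_left _ _, hlevel, fun g => ?_, fun Z hZ => ?_, fun Z hZ hs hi => ?_,
    fun g hg => ?_⟩
  · rw [hgmf, H.mem_gmf, hlevel, ← and_or_left]
    change _ ↔ _ ∧ g.card ≤ s.k + 1
    rw [Nat.le_add_one_iff]
  · rcases (hborder Z).1 hZ with h | h
    exacts [H.supp_lt_of_mem_border Z h, h.2]
  · rw [hborder]
    rcases Nat.le_add_one_iff.1 hZ with h | h
    · exact Or.inl (H.mem_border Z h hs hi)
    · -- A minimal infrequent pattern is a minimal generator, so it is a candidate.
      have hZgen : IsGen K Z := isGen_iff.2 fun i hiZ h' => by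
        have := hi i hiZ
        omega
      exact Or.inr ⟨hcand Z h fun i hiZ =>
        mem_GMF.2 ⟨hZgen.subset (Finset.erase_subset _ _), hi i hiZ⟩, hs⟩
  · change calculSupport K (candidates s) s.support g = K.supp g
    by_cases hc : g ∈ candidates s
    · exact hsup g hc
    · rw [calculSupport, if_neg hc]
      rcases (hgmf g).1 hg with h | h
      · exact H.support_eq g h
      · rw [hlevel] at h
        exact absurd (hcand g h.2 fun i _ => mem_GMF_of_subset h.1 (Finset.erase_subset _ _)) hc

/-- What the later steps use of the result of `Gen-GMs`: it determines the frequent minimal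
generators and the supports of all patterns. -/
structure GenCorrect (K : Context O I) (minsupp : ℕ) (S : GenResult I) : Prop where
  gmf_eq : S.gmf = K.GMF minsupp
  support_eq : ∀ g ∈ K.GMF minsupp, S.support g = K.supp g
  border_iff : ∀ U, (∃ Z ∈ S.border, Z ⊆ U) ↔ K.supp U < minsupp
  closureEmpty_eq : S.closureEmpty = K.gamma ∅

theorem exists_mem_genGMs (hminsupp : minsupp ≤ Fintype.card O) :
    ∃ S ∈ genGMs K minsupp, GenCorrect K minsupp S := by
  obtain ⟨s, hs, -, ⟨H, -⟩, hlevel⟩ := exists_mem_whileLoop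
    (cond := fun s : GenState I => decide (s.level ≠ ∅)) (body := genGMsNext K minsupp)
    (fun k s => GenInv K minsupp s ∧ s.k = k + 1) (Fintype.card I)
    (fun k s hs _ => ⟨hs.1.next, congrArg (· + 1) hs.2⟩)
    (fun k s hs hc => by
      obtain ⟨g, hg⟩ := Finset.nonempty_iff_ne_empty.2 (of_decide_eq_true hc)
      have h1 := ((hs.1.mem_level g).1 hg).2
      have h2 := Finset.card_le_univ g
      have h3 := hs.2
      omega)
    (s := genGMsInit K minsupp) ⟨genInv_init hminsupp, rfl⟩
  have hempty : s.level = ∅ := by simpa using hlevel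
  -- A generator of size at least `s.k` would have a subset in the last level, which is empty.
  have hcard : ∀ g ∈ K.GMF minsupp, g.card < s.k := by
    intro g hg
    by_contra! hk
    obtain ⟨h, hhg, hh⟩ := Finset.exists_subset_card_eq hk
    have := (H.mem_level h).2 ⟨mem_GMF_of_subset hg hhg, hh⟩
    simp [hempty] at this
  have hgmf : ∀ g, g ∈ s.gmf ↔ g ∈ K.GMF minsupp := fun g =>
    (H.mem_gmf g).trans ⟨fun h => h.1, fun h => ⟨h, (hcard g h).le⟩⟩
  refine ⟨_, Part.mem_map _ hs, Finset.ext hgmf,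
    fun g hg => H.support_eq g ((hgmf g).2 hg), fun U => ⟨?_, ?_⟩, ?_⟩
  · rintro ⟨Z, hZ, hZU⟩
    exact (supp_anti hZU).trans_lt (H.supp_lt_of_mem_border Z hZ)
  · intro hU
    obtain ⟨Z, hZU, hZ⟩ := exists_minimal_le_of_wellFoundedLT
      (fun Z => K.supp Z < minsupp) U hU
    have hZi : ∀ i ∈ Z, minsupp ≤ K.supp (Z.erase i) := by
      intro i hi
      by_contra! hlt
      exact (Finset.erase_ssubset hi).not_subset (hZ.le_of_le hlt (Finset.erase_subset _ _))
    have hZgen : IsGen K Z := isGen_iff.2 fun i hiZ h' => by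
      have := hZi i hiZ
      have := hZ.prop
      omega
    refine ⟨Z, H.mem_border Z ?_ hZ.prop hZi, hZU⟩
    rcases Z.eq_empty_or_nonempty with rfl | ⟨i, hi⟩
    · simp
    · have := hcard _ (mem_GMF.2 ⟨hZgen.subset (Finset.erase_subset i Z), hZi i hi⟩)
      rw [Finset.card_erase_of_mem hi] at this
      omega
  · ext i
    simp only [Finset.mem_filter, Finset.mem_univ, true_and, itemSupport_singleton]
    rw [← Finset.singleton_subset_iff, ← gamma_subset_gamma_iff, ← supp_union_eq_iff,
      Finset.empty_union, supp_empty]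

end StepOne

/-! ### Comparison of classes by supports -/

section Comparison

variable {O I : Type*} [Fintype O] [Fintype I] [LinearOrder I] {K : Context O I} {minsupp : ℕ}
  {S : GenResult I} {a b : Finset I}

theorem GenCorrect.derivedSupport_eq (H : GenCorrect K minsupp S)
    (hminsupp : minsupp ≤ Fintype.card O) (U : Finset I) :
    derivedSupport S U = if minsupp ≤ K.supp U then some (K.supp U) else none := by
  rw [derivedSupport]
  by_cases hU : minsupp ≤ K.supp U
  · rw [if_neg fun h => hU.not_gt ((H.border_iff U).1 h), if_pos hU]
    congr 1
    have hempty : ∅ ∈ K.GMF minsupp := mem_GMF.2 ⟨isGen_empty, by rwa [supp_empty]⟩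
    apply le_antisymm
    · rw [Finset.fold_min_le]
      obtain ⟨g, hgU, hg, hc⟩ := exists_mem_GMF_subset U hU
      refine Or.inr ⟨g, Finset.mem_filter.2 ⟨H.gmf_eq ▸ hg, hgU⟩, ?_⟩
      rw [H.support_eq g hg, supp_eq_of_gamma_eq hc]
    · rw [Finset.le_fold_min, H.support_eq _ hempty]
      refine ⟨supp_anti (Finset.empty_subset U), fun g hg => ?_⟩
      rw [Finset.mem_filter, H.gmf_eq] at hg
      rw [H.support_eq g hg.1]
      exact supp_anti hg.2
  · rw [if_pos ((H.border_iff U).2 (not_le.1 hU)), if_neg hU]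

theorem GenCorrect.derivedSupport_union (H : GenCorrect K minsupp S)
    (hminsupp : minsupp ≤ Fintype.card O) (ha : a ∈ K.GMF minsupp) :
    derivedSupport S (a ∪ b) = some (S.support a) ↔ K.gamma b ⊆ K.gamma a := by
  rw [← supp_union_eq_iff, H.derivedSupport_eq hminsupp, H.support_eq a ha]
  split_ifs with hU
  · simp
  · simp only [false_iff]
    intro h
    exact hU (h ▸ (mem_GMF.1 ha).2)

theorem GenCorrect.equiv_iff (H : GenCorrect K minsupp S) (hminsupp : minsupp ≤ Fintype.card O)
    (ha : a ∈ K.GMF minsupp) (hb : b ∈ K.GMF minsupp) :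
    Prince.Equiv S a b ↔ K.gamma a = K.gamma b := by
  rw [Prince.Equiv, H.derivedSupport_union hminsupp ha, H.support_eq a ha, H.support_eq b hb]
  exact ⟨fun h => (gamma_eq_of_subset_gamma_of_supp_le h.2 h.1.ge).symm,
    fun h => ⟨supp_eq_of_gamma_eq h, h.ge⟩⟩

theorem GenCorrect.succ_iff (H : GenCorrect K minsupp S) (hminsupp : minsupp ≤ Fintype.card O)
    (ha : a ∈ K.GMF minsupp) (hb : b ∈ K.GMF minsupp) :
    Prince.Succ S a b ↔ K.gamma b ⊂ K.gamma a := by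
  rw [Prince.Succ, H.derivedSupport_union hminsupp ha, H.support_eq a ha, H.support_eq b hb]
  exact ⟨fun h => h.2.ssubset_of_ne fun h' => h.1.ne (supp_eq_of_gamma_eq h'.symm),
    fun h => ⟨supp_lt_of_gamma_ssubset h, h.subset⟩⟩

end Comparison

/-! ### The order of treatment of the generators -/

section LexOrder

variable {I : Type*} [LinearOrder I]

theorem toFinset_word (g : Finset I) : (word g).toFinset = g := Finset.sort_toFinset _ _

theorem lexLT_irrefl (g : Finset I) : ¬ lexLT g g := lt_irrefl (word g)

theorem mem_lexList {G : Finset (Finset I)} {g : Finset I} : g ∈ lexList G ↔ g ∈ G := by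
  simp [lexList, toFinset_word]

theorem pairwise_lexList (G : Finset (Finset I)) : (lexList G).Pairwise lexLT := by
  rw [lexList, List.pairwise_map]
  refine (Finset.sortedLT_sort (G.image word)).pairwise.imp_of_mem fun {a b} ha hb hab => ?_
  simp only [Finset.mem_sort, Finset.mem_image] at ha hb
  obtain ⟨g, -, rfl⟩ := ha
  obtain ⟨h, -, rfl⟩ := hb
  rw [toFinset_word, toFinset_word]
  exact hab

theorem mem_tau {g h : Finset I} : h ∈ tau g ↔ ∃ i ∈ g, g.erase i = h :=
  mem_lexList.trans mem_immediateSubsets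

/-- The frequent minimal generators in the order in which `Gen-Ordre` treats them. -/
def treatmentList (S : GenResult I) : List (Finset I) :=
  ((S.gmf.image S.support).sort (· ≥ ·)).flatMap fun n =>
    lexList (S.gmf.filter fun g => S.support g = n)

theorem mem_treatmentList {S : GenResult I} {g : Finset I} :
    g ∈ treatmentList S ↔ g ∈ S.gmf := by
  simp only [treatmentList, List.mem_flatMap, Finset.mem_sort, Finset.mem_image, mem_lexList,
    Finset.mem_filter]
  exact ⟨fun ⟨_, _, h⟩ => h.1, fun h => ⟨_, ⟨g, h, rfl⟩, h, rfl⟩⟩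

theorem pairwise_treatmentList (S : GenResult I) : (treatmentList S).Pairwise fun a b =>
    S.support b < S.support a ∨ S.support a = S.support b ∧ lexLT a b := by
  rw [treatmentList, List.pairwise_flatMap]
  constructor
  · intro n _
    refine (pairwise_lexList _).imp_of_mem fun {a b} ha hb hab => Or.inr ⟨?_, hab⟩
    rw [mem_lexList, Finset.mem_filter] at ha hb
    rw [ha.2, hb.2]
  · have hnodup := Finset.sort_nodup (S.gmf.image S.support) (· ≥ ·)
    refine ((Finset.pairwise_sort (S.gmf.image S.support) (· ≥ ·)).and hnodup).imp ?_
    rintro m n ⟨hmn, hne⟩ a ha b hb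
    rw [mem_lexList, Finset.mem_filter] at ha hb
    rw [ha.2, hb.2]
    exact Or.inl (lt_of_le_of_ne hmn hne.symm)

theorem genOrdre_eq_foldl (S : GenResult I) :
    genOrdre S = (treatmentList S).foldl (fun s g => insertGen S (S.support g) s g)
      { X := [], f := fun _ => [], lattice := [] } := by
  rw [treatmentList, List.foldl_flatMap, genOrdre]
  refine List.foldl_ext _ _ _ fun s n _ => List.foldl_ext _ _ _ fun s g hg => ?_
  rw [mem_lexList, Finset.mem_filter] at hg
  rw [hg.2]

end LexOrder

/-- An invariant `P p s` relating the state of a left fold to the prefix `p` treated so far. -/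
theorem foldl_induction_prefix {α σ : Type*} {f : σ → α → σ} (P : List α → σ → Prop)
    {l : List α} (hstep : ∀ p a q s, l = p ++ a :: q → P p s → P (p ++ [a]) (f s a)) {s : σ}
    (h0 : P [] s) : P l (l.foldl f s) := by
  suffices H : ∀ q p s, l = p ++ q → P p s → P l (q.foldl f s) from H l [] s rfl h0
  intro q
  induction q with
  | nil =>
    intro p s hl hp
    rw [List.append_nil] at hl
    rwa [hl]
  | cons a q ih =>
    intro p s hl hp
    exact ih (p ++ [a]) (f s a) (by simpa using hl) (hstep p a q s hl hp)

/-! ### Classes, representatives and arcs -/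

/-- In a list sorted by decreasing support, `scan` meets all elements of support `> n`. -/
theorem scan_spec {I : Type*} {S : GenResult I} {n : ℕ} {l : List (Finset I)}
    (hl : l.Pairwise fun a b => S.support b ≤ S.support a) (pred : List (Finset I)) :
    (∀ h, h ∈ (scan S n l pred).1 ↔ h ∈ pred ∨ (h ∈ l ∧ n < S.support h)) ∧
    (∀ F, (scan S n l pred).2 = some F → F ∈ l ∧ ¬ n < S.support F) ∧
    ((scan S n l pred).2 = none → ∀ h ∈ l, n < S.support h) := by
  induction l generalizing pred with
  | nil => simp [scan]
  | cons F l ih =>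
    rw [List.pairwise_cons] at hl
    rw [scan]
    split_ifs with hF
    · obtain ⟨h1, h2, h3⟩ := ih hl.2 (pred ++ [F])
      refine ⟨fun h => ?_, fun F' hF' => ?_, fun hn h hh => ?_⟩
      · rw [h1, List.mem_append, List.mem_singleton, List.mem_cons]
        constructor
        · rintro ((h | rfl) | h)
          · exact Or.inl h
          · exact Or.inr ⟨Or.inl rfl, hF⟩
          · exact Or.inr ⟨Or.inr h.1, h.2⟩
        · rintro (h | ⟨h | h, h'⟩)
          · exact Or.inl (Or.inl h)
          · exact Or.inl (Or.inr h)
          · exact Or.inr ⟨h, h'⟩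
      · exact ⟨List.mem_cons_of_mem _ (h2 F' hF').1, (h2 F' hF').2⟩
      · rcases List.mem_cons.1 hh with rfl | hh
        exacts [hF, h3 hn h hh]
    · refine ⟨fun h => ?_, fun F' hF' => ?_, fun hn => by simp at hn⟩
      · simp only [List.mem_cons, iff_self_or, and_imp]
        rintro (rfl | hh) hlt
        · exact absurd hlt hF
        · exact absurd (hlt.trans_le (hl.1 h hh)) hF
      · cases hF'
        exact ⟨List.mem_cons_self, hF⟩

theorem mem_phi_iff {I : Type*} [LinearOrder I] {S : GenResult I} {s : OrdreState I} {n : ℕ}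
    {g g₁ h : Finset I} : h ∈ phi S s n g g₁ ↔ h ∈ s.X ∧
      ((S.support h = n ∧ Succ S h (s.rep g₁) ∧ Equiv S h g ∧ lexLT h g) ∨
       (n < S.support h ∧ (h = s.rep g₁ ∨ Succ S h (s.rep g₁)) ∧ Succ S g h ∧
         ∀ h' ∈ s.X, n < S.support h' → Succ S h' h → ¬ Succ S g h')) := by
  rw [phi, List.mem_filter, decide_eq_true_iff]

section StepTwo

variable {O I : Type*} [Fintype O] [Fintype I] [LinearOrder I] {K : Context O I} {minsupp : ℕ}
  {S : GenResult I}

/-- The invariant of `Gen-Ordre` on representatives and classes, `p` being the list of the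
generators treated so far. -/
structure ClassInv (K : Context O I) (p : List (Finset I)) (s : OrdreState I) : Prop where
  mem_of_mem_X : ∀ R ∈ s.X, R ∈ p
  pairwise_X : s.X.Pairwise fun a b => K.supp b ≤ K.supp a ∧ K.gamma a ≠ K.gamma b
  exists_mem_X : ∀ g ∈ p, ∃ R ∈ s.X, K.gamma R = K.gamma g
  mem_f : ∀ R ∈ s.X, ∀ t, t ∈ s.f R ↔ t ∈ p ∧ K.gamma t = K.gamma R

theorem ClassInv.eq_of_gamma_eq {p : List (Finset I)} {s : OrdreState I} (C : ClassInv K p s)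
    {R R' : Finset I} (hR : R ∈ s.X) (hR' : R' ∈ s.X) (h : K.gamma R = K.gamma R') : R = R' := by
  let r : Finset I → Finset I → Prop := fun a b => a ≠ b → K.gamma a ≠ K.gamma b
  have : Std.Symm r := ⟨fun a b hab hne => (hab hne.symm).symm⟩
  have hpw : s.X.Pairwise r := C.pairwise_X.imp fun {a b} h _ => h.2
  by_contra hne
  exact hpw.forall_of_forall (fun x _ hx => absurd rfl hx) hR hR' hne h

theorem ClassInv.rep_spec {p : List (Finset I)} {s : OrdreState I} (C : ClassInv K p s)
    {g : Finset I} (hg : g ∈ p) : s.rep g ∈ s.X ∧ K.gamma (s.rep g) = K.gamma g := by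
  obtain ⟨R, hR, hRg⟩ := C.exists_mem_X g hg
  have hsome : (s.X.find? fun R => decide (g ∈ s.f R)).isSome := by
    rw [List.find?_isSome]
    exact ⟨R, hR, decide_eq_true ((C.mem_f R hR g).2 ⟨hg, hRg.symm⟩)⟩
  obtain ⟨R', hR'⟩ := Option.isSome_iff_exists.1 hsome
  have hX := List.mem_of_find?_eq_some hR'
  have hf := of_decide_eq_true (List.find?_some (p := fun R => decide (g ∈ s.f R)) hR')
  rw [OrdreState.rep, hR', Option.getD_some]
  exact ⟨hX, ((C.mem_f R' hX g).1 hf).2.symm⟩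

/-- The immediate predecessors of the class of `g` which `φ(n, g, g₁)` contributes: those above
the class of `g₁`. -/
def IsPredVia (K : Context O I) (minsupp : ℕ) (s : OrdreState I) (g g₁ h : Finset I) : Prop :=
  h ∈ s.X ∧ K.gamma g₁ ⊆ K.gamma h ∧ K.gamma h ∈ K.lowerCover minsupp (K.gamma g)

/-- The set `φ(n, g, g₁)` in terms of closures, in any state in which all generators of support
greater than `n` have been treated. -/
theorem ClassInv.mem_phi {p : List (Finset I)} {s : OrdreState I} (C : ClassInv K p s)
    (H : GenCorrect K minsupp S) (hminsupp : minsupp ≤ Fintype.card O)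
    (hp : ∀ h ∈ p, h ∈ K.GMF minsupp) {g g₁ : Finset I} (hg : g ∈ K.GMF minsupp)
    (hpg : ∀ h ∈ K.GMF minsupp, K.supp g < K.supp h → h ∈ p) (hg₁ : g₁ ∈ p)
    (hlt : K.gamma g₁ ⊂ K.gamma g) {h : Finset I} :
    h ∈ phi S s (K.supp g) g g₁ ↔
      (h ∈ s.X ∧ K.gamma h = K.gamma g ∧ lexLT h g) ∨ IsPredVia K minsupp s g g₁ h := by
  obtain ⟨hrX, hrγ⟩ := C.rep_spec hg₁
  have hX : ∀ R ∈ s.X, R ∈ K.GMF minsupp := fun R hR => hp R (C.mem_of_mem_X R hR)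
  have hrep := hX _ hrX
  have hcover : ∀ h ∈ s.X, K.gamma h ⊂ K.gamma g →
      ((∀ h' ∈ s.X, K.supp g < S.support h' → Succ S h' h → ¬ Succ S g h') ↔
        K.gamma h ∈ K.lowerCover minsupp (K.gamma g)) := by
    intro h hh hhg
    constructor
    · intro hall
      refine ⟨gamma_mem_IFF.2 (mem_GMF.1 (hX h hh)).2, hhg, fun f₂ hf₂ ⟨h1, h2⟩ => ?_⟩
      obtain ⟨hf₂c, hf₂s⟩ := mem_IFF.1 hf₂
      obtain ⟨g₂, -, hg₂, hg₂c⟩ := exists_mem_GMF_subset f₂ hf₂s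
      rw [hf₂c] at hg₂c
      rw [← hg₂c] at h1 h2
      obtain ⟨R, hR, hRc⟩ := C.exists_mem_X g₂ (hpg g₂ hg₂ (supp_lt_of_gamma_ssubset h2))
      rw [← hRc] at h1 h2
      refine hall R hR ?_ ?_ ?_
      · rw [H.support_eq R (hX R hR)]
        exact supp_lt_of_gamma_ssubset h2
      · rwa [H.succ_iff hminsupp (hX R hR) (hX h hh)]
      · rwa [H.succ_iff hminsupp hg (hX R hR)]
    · intro hc h' hh' _ h1 h2
      rw [H.succ_iff hminsupp (hX h' hh') (hX h hh)] at h1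
      rw [H.succ_iff hminsupp hg (hX h' hh')] at h2
      exact hc.2.2 _ (gamma_mem_IFF.2 (mem_GMF.1 (hX h' hh')).2) ⟨h1, h2⟩
  rw [mem_phi_iff, IsPredVia, ← and_or_left]
  refine and_congr_right fun hh => ?_
  have hhG := hX h hh
  rw [H.succ_iff hminsupp hhG hrep, H.equiv_iff hminsupp hhG hg, H.succ_iff hminsupp hg hhG,
    H.support_eq h hhG, hrγ]
  refine or_congr ⟨fun hc => hc.2.2, fun hc => ⟨supp_eq_of_gamma_eq hc.1, hc.1 ▸ hlt, hc⟩⟩ ?_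
  constructor
  · rintro ⟨-, h1, h2, h3⟩
    refine ⟨?_, (hcover h hh h2).1 h3⟩
    rcases h1 with rfl | h1
    · exact hrγ.ge
    · exact h1.subset
  · rintro ⟨h1, h2⟩
    refine ⟨supp_lt_of_gamma_ssubset h2.2.1, ?_, h2.2.1, (hcover h hh h2.2.1).2 h2⟩
    by_cases he : K.gamma g₁ = K.gamma h
    · exact Or.inl (C.eq_of_gamma_eq hh hrX (he.symm.trans hrγ.symm))
    · exact Or.inr (h1.ssubset_of_ne he)

theorem ClassInv.scan_phi {p : List (Finset I)} {s : OrdreState I} (C : ClassInv K p s)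
    (H : GenCorrect K minsupp S) (hminsupp : minsupp ≤ Fintype.card O)
    (hp : ∀ h ∈ p, h ∈ K.GMF minsupp) {g g₁ : Finset I} (hg : g ∈ K.GMF minsupp)
    (hpg : ∀ h ∈ K.GMF minsupp, K.supp g < K.supp h → h ∈ p) (hg₁ : g₁ ∈ p)
    (hlt : K.gamma g₁ ⊂ K.gamma g) (pred : List (Finset I)) :
    (∀ h, h ∈ (scan S (K.supp g) (phi S s (K.supp g) g g₁) pred).1 ↔
      h ∈ pred ∨ IsPredVia K minsupp s g g₁ h) ∧
    (∀ F, (scan S (K.supp g) (phi S s (K.supp g) g g₁) pred).2 = some F →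
      F ∈ s.X ∧ K.gamma F = K.gamma g) ∧
    ((scan S (K.supp g) (phi S s (K.supp g) g g₁) pred).2 = none →
      ∀ F ∈ s.X, K.gamma F = K.gamma g → ¬ lexLT F g) := by
  have hX : ∀ R ∈ s.X, S.support R = K.supp R := fun R hR =>
    H.support_eq R (hp R (C.mem_of_mem_X R hR))
  have hl : (phi S s (K.supp g) g g₁).Pairwise fun a b => S.support b ≤ S.support a := by
    refine List.Pairwise.filter _ (C.pairwise_X.imp_of_mem fun {a b} ha hb hab => ?_)
    rw [hX a ha, hX b hb]
    exact hab.1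
  have hphi := fun h => C.mem_phi (h := h) H hminsupp hp hg hpg hg₁ hlt
  obtain ⟨h1, h2, h3⟩ := scan_spec (S := S) (n := K.supp g) hl pred
  have hpred : ∀ h, IsPredVia K minsupp s g g₁ h → K.supp g < S.support h := fun h hh => by
    rw [hX h hh.1]
    exact supp_lt_of_gamma_ssubset hh.2.2.2.1
  refine ⟨fun h => ?_, fun F hF => ?_, fun hn F hF hFg hlex => ?_⟩
  · rw [h1, hphi]
    refine or_congr_right ⟨?_, fun hh => ⟨Or.inr hh, hpred h hh⟩⟩
    rintro ⟨⟨hh, hc, -⟩ | hh, hlt'⟩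
    · rw [hX h hh, supp_eq_of_gamma_eq hc] at hlt'
      exact absurd hlt' (lt_irrefl _)
    · exact hh
  · obtain ⟨h4, h5⟩ := h2 F hF
    rcases (hphi F).1 h4 with h6 | h6
    · exact ⟨h6.1, h6.2.1⟩
    · exact absurd (hpred F h6) h5
  · have := h3 hn F ((hphi F).2 (Or.inl ⟨hF, hFg, hlex⟩))
    rw [hX F hF, supp_eq_of_gamma_eq hFg] at this
    exact lt_irrefl _ this

/-- Block C visits an initial segment `v` of the list of immediate subsets and collects the
predecessors seen from its elements. If no representative is met, then `v` is the whole list, and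
the class of `g` is new unless the list is empty. -/
theorem ClassInv.blockC_spec {p : List (Finset I)} {s : OrdreState I} (C : ClassInv K p s)
    (H : GenCorrect K minsupp S) (hminsupp : minsupp ≤ Fintype.card O)
    (hp : ∀ h ∈ p, h ∈ K.GMF minsupp) {g : Finset I} (hg : g ∈ K.GMF minsupp)
    (hpg : ∀ h ∈ K.GMF minsupp, K.supp g < K.supp h → h ∈ p) (l pred : List (Finset I))
    (hl : ∀ g₁ ∈ l, g₁ ∈ p ∧ K.gamma g₁ ⊂ K.gamma g) :
    ∃ v, l = v ++ (blockC S s (K.supp g) g l pred).2.2 ∧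
      (∀ h, h ∈ (blockC S s (K.supp g) g l pred).1 ↔
        h ∈ pred ∨ ∃ g₁ ∈ v, IsPredVia K minsupp s g g₁ h) ∧
      (∀ F, (blockC S s (K.supp g) g l pred).2.1 = some F → F ∈ s.X ∧ K.gamma F = K.gamma g) ∧
      ((blockC S s (K.supp g) g l pred).2.1 = none →
        (blockC S s (K.supp g) g l pred).2.2 = [] ∧
          (l ≠ [] → ∀ F ∈ s.X, K.gamma F = K.gamma g → ¬ lexLT F g)) := by
  induction l generalizing pred with
  | nil => exact ⟨[], by simp [blockC]⟩
  | cons g₁ l ih =>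
    obtain ⟨hg₁, hl⟩ := List.forall_mem_cons.1 hl
    obtain ⟨h1, h2, h3⟩ := C.scan_phi H hminsupp hp hg hpg hg₁.1 hg₁.2 pred
    rcases hsc : scan S (K.supp g) (phi S s (K.supp g) g g₁) pred with ⟨pred', _ | F⟩
    · rw [hsc] at h1 h3
      have hb : blockC S s (K.supp g) g (g₁ :: l) pred = blockC S s (K.supp g) g l pred' := by
        simp only [blockC, hsc]
      obtain ⟨v, e1, e2, e3, e4⟩ := ih pred' hl
      rw [hb]
      refine ⟨g₁ :: v, by rw [List.cons_append, ← e1], fun h => ?_, e3,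
        fun hn => ⟨(e4 hn).1, fun _ => h3 rfl⟩⟩
      rw [e2, h1, or_assoc, List.exists_mem_cons_iff]
    · rw [hsc] at h1 h2
      have hb : blockC S s (K.supp g) g (g₁ :: l) pred = (pred', some F, l) := by
        simp only [blockC, hsc]
      rw [hb]
      refine ⟨[g₁], rfl, fun h => ?_, fun F' hF' => h2 F' hF', fun hn => by simp at hn⟩
      rw [h1]
      simp

/-- Block F only adds arcs: those from the predecessors seen from the immediate subsets in `l`. -/
theorem ClassInv.foldl_blockF_spec {p : List (Finset I)} {s : OrdreState I} (C : ClassInv K p s)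
    (H : GenCorrect K minsupp S) (hminsupp : minsupp ≤ Fintype.card O)
    (hp : ∀ h ∈ p, h ∈ K.GMF minsupp) {R : Finset I} (hR : R ∈ K.GMF minsupp)
    (hpR : ∀ h ∈ K.GMF minsupp, K.supp R < K.supp h → h ∈ p) (l : List (Finset I))
    (hl : ∀ g₁ ∈ l, g₁ ∈ p ∧ K.gamma g₁ ⊂ K.gamma R) :
    (l.foldl (blockF S (K.supp R) R) s).X = s.X ∧ (l.foldl (blockF S (K.supp R) R) s).f = s.f ∧
      ∀ h R', (h, R') ∈ (l.foldl (blockF S (K.supp R) R) s).lattice ↔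
        (h, R') ∈ s.lattice ∨ R = R' ∧ ∃ g₁ ∈ l, IsPredVia K minsupp s R g₁ h := by
  induction l generalizing s with
  | nil => simp
  | cons g₁ l ih =>
    obtain ⟨hg₁, hl⟩ := List.forall_mem_cons.1 hl
    have C' : ClassInv K p (blockF S (K.supp R) R s g₁) := ⟨C.1, C.2, C.3, C.4⟩
    obtain ⟨e1, e2, e3⟩ := ih C' hl
    refine ⟨e1, e2, fun h R' => ?_⟩
    have h1 := (C.scan_phi H hminsupp hp hR hpR hg₁.1 hg₁.2 []).1 h
    simp only [List.not_mem_nil, false_or] at h1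
    rw [List.foldl_cons, e3, List.exists_mem_cons_iff]
    change (h, R') ∈ s.lattice ++ _ ∨ R = R' ∧ (∃ g₁ ∈ l, IsPredVia K minsupp s R g₁ h) ↔ _
    rw [List.mem_append, or_assoc]
    refine or_congr_right ?_
    simp only [List.mem_map, Prod.mk.injEq, ← h1]
    constructor
    · rintro (⟨F, hF, rfl, rfl⟩ | ⟨h2, h3⟩)
      exacts [⟨rfl, Or.inl hF⟩, ⟨h2, Or.inr h3⟩]
    · rintro ⟨h2, h3 | h3⟩
      exacts [Or.inl ⟨h, h3, rfl, h2⟩, Or.inr ⟨h2, h3⟩]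

/-- Block E preserves the invariant on classes, provided that it receives the representative of the
class of `g` exactly if there is one. -/
theorem ClassInv.blockE_spec {p : List (Finset I)} {s : OrdreState I} (C : ClassInv K p s)
    {g : Finset I} (hle : ∀ h ∈ p, K.supp g ≤ K.supp h) {o : Option (Finset I)}
    (hsome : ∀ F, o = some F → F ∈ s.X ∧ K.gamma F = K.gamma g)
    (hnone : o = none → ∀ F ∈ s.X, K.gamma F ≠ K.gamma g) :
    ClassInv K (p ++ [g]) (blockE s g o).1 ∧ (blockE s g o).1.lattice = s.lattice ∧
      (blockE s g o).2 ∈ (blockE s g o).1.X ∧ K.gamma (blockE s g o).2 = K.gamma g ∧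
      (∀ h ∈ s.X, h ∈ (blockE s g o).1.X) ∧
      ∀ h ∈ (blockE s g o).1.X, h ∈ s.X ∨ h = g ∧ ∀ F ∈ s.X, K.gamma F ≠ K.gamma g := by
  have happ : ∀ t R, (t ∈ p ++ [g] ∧ K.gamma t = K.gamma R) ↔
      (t ∈ p ∧ K.gamma t = K.gamma R) ∨ t = g ∧ K.gamma g = K.gamma R := by
    intro t R
    rw [List.mem_append, List.mem_singleton, or_and_right]
    refine or_congr_right (and_congr_right fun ht => by rw [ht])
  rcases o with _ | F
  · have hX := hnone rfl
    have hp : ∀ t ∈ p, K.gamma t ≠ K.gamma g := by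
      intro t ht htg
      obtain ⟨R, hR, hRt⟩ := C.exists_mem_X t ht
      exact hX R hR (hRt.trans htg)
    refine ⟨⟨?_, ?_, ?_, ?_⟩, rfl, ?_, rfl, fun h hh => List.mem_append_left _ hh, ?_⟩
    · intro R hR
      rcases List.mem_append.1 hR with hR | hR
      · exact List.mem_append_left _ (C.mem_of_mem_X R hR)
      · exact List.mem_append_right _ hR
    · change (s.X ++ [g]).Pairwise _
      rw [List.pairwise_append]
      refine ⟨C.pairwise_X, List.pairwise_singleton _ _, fun a ha b hb => ?_⟩
      rw [List.mem_singleton.1 hb]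
      exact ⟨hle a (C.mem_of_mem_X a ha), hX a ha⟩
    · intro t ht
      rcases List.mem_append.1 ht with ht | ht
      · obtain ⟨R, hR, hRt⟩ := C.exists_mem_X t ht
        exact ⟨R, List.mem_append_left _ hR, hRt⟩
      · exact ⟨t, List.mem_append_right _ ht, rfl⟩
    · intro R hR t
      change t ∈ Function.update s.f g [g] R ↔ _
      rw [happ]
      rcases List.mem_append.1 hR with hR | hR
      · have hRg : R ≠ g := fun h => hX R hR (by rw [h])
        rw [Function.update_of_ne hRg, C.mem_f R hR, iff_self_or]
        exact fun h => absurd h.2.symm (hX R hR)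
      · rw [List.mem_singleton.1 hR, Function.update_self, List.mem_singleton]
        exact ⟨fun h => Or.inr ⟨h, rfl⟩,
          fun h => h.elim (fun h => absurd h.2 (hp t h.1)) fun h => h.1⟩
    · exact List.mem_append_right _ (List.mem_singleton_self g)
    · intro h hh
      rcases List.mem_append.1 hh with hh | hh
      · exact Or.inl hh
      · exact Or.inr ⟨List.mem_singleton.1 hh, hX⟩
  · obtain ⟨hF, hFg⟩ := hsome F rfl
    refine ⟨⟨fun R hR => List.mem_append_left _ (C.mem_of_mem_X R hR), C.pairwise_X, ?_, ?_⟩,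
      rfl, hF, hFg, fun h hh => hh, fun h hh => Or.inl hh⟩
    · intro t ht
      rcases List.mem_append.1 ht with ht | ht
      · exact C.exists_mem_X t ht
      · exact ⟨F, hF, by rw [hFg, List.mem_singleton.1 ht]⟩
    · intro R hR t
      change t ∈ Function.update s.f F (s.f F ++ [g]) R ↔ _
      rw [happ]
      by_cases hRF : R = F
      · rw [hRF, Function.update_self, List.mem_append, C.mem_f F hF, List.mem_singleton]
        exact or_congr_right ⟨fun h => ⟨h, hFg.symm⟩, fun h => h.1⟩
      · rw [Function.update_of_ne hRF, C.mem_f R hR, iff_self_or]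
        exact fun h => absurd (C.eq_of_gamma_eq hR hF (h.2.symm.trans hFg.symm)) hRF

/-- The invariant of `Gen-Ordre`: an arc joins two classes if one immediately precedes the other
and this is witnessed by an immediate subset of one of the generators treated so far. -/
structure OrdreInv (K : Context O I) (minsupp : ℕ) (p : List (Finset I)) (s : OrdreState I) :
    Prop extends ClassInv K p s where
  mem_lattice : ∀ h R, (h, R) ∈ s.lattice ↔ h ∈ s.X ∧ R ∈ s.X ∧
    K.gamma h ∈ K.lowerCover minsupp (K.gamma R) ∧
    ∃ g ∈ p, K.gamma g = K.gamma R ∧ ∃ g₁ ∈ tau g, K.gamma g₁ ⊆ K.gamma h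

theorem OrdreInv.insertGen {p : List (Finset I)} {s : OrdreState I}
    (A : OrdreInv K minsupp p s) (H : GenCorrect K minsupp S)
    (hminsupp : minsupp ≤ Fintype.card O) (hp : ∀ h ∈ p, h ∈ K.GMF minsupp) {g : Finset I}
    (hg : g ∈ K.GMF minsupp) (hpg : ∀ h ∈ K.GMF minsupp, K.supp g < K.supp h → h ∈ p)
    (hbefore : ∀ h ∈ p, K.supp g < K.supp h ∨ K.supp h = K.supp g ∧ lexLT h g) :
    OrdreInv K minsupp (p ++ [g]) (insertGen S (K.supp g) s g) := by
  have htau : ∀ g₁ ∈ tau g, g₁ ∈ p ∧ K.gamma g₁ ⊂ K.gamma g := by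
    intro g₁ hg₁
    obtain ⟨i, hi, rfl⟩ := mem_tau.1 hg₁
    have hlt := (mem_GMF.1 hg).1.gamma_erase_ssubset hi
    exact ⟨hpg _ (mem_GMF_of_subset hg (Finset.erase_subset _ _)) (supp_lt_of_gamma_ssubset hlt),
      hlt⟩
  have hlex : ∀ h ∈ p, K.gamma h = K.gamma g → lexLT h g := by
    intro h hh hhg
    rcases hbefore h hh with hlt | hh
    · rw [supp_eq_of_gamma_eq hhg] at hlt
      exact absurd hlt (lt_irrefl _)
    · exact hh.2
  have hle : ∀ h ∈ p, K.supp g ≤ K.supp h := fun h hh =>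
    (hbefore h hh).elim (fun h => h.le) fun h => h.1.ge
  obtain ⟨v, hv, hc1, hc2, hc3⟩ := A.blockC_spec H hminsupp hp hg hpg (tau g) [] htau
  have hnone : (blockC S s (K.supp g) g (tau g) []).2.1 = none →
      ∀ F ∈ s.X, K.gamma F ≠ K.gamma g := by
    intro hn F hF hFg
    have hFp := A.mem_of_mem_X F hF
    by_cases ht : tau g = []
    · -- Only the empty set has no immediate subset, and its class has no other generator.
      have hgempty : g = ∅ := by
        by_contra hne
        obtain ⟨i, hi⟩ := Finset.nonempty_iff_ne_empty.2 hne
        have : g.erase i ∈ tau g := mem_tau.2 ⟨i, hi, rfl⟩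
        simp [ht] at this
      have hFempty : F = ∅ := by
        by_contra hne
        exact (mem_GMF.1 (hp F hFp)).1 ∅ (Finset.empty_ssubset.2
          (Finset.nonempty_iff_ne_empty.2 hne)) (hgempty ▸ hFg.symm)
      have := hlex F hFp hFg
      rw [hgempty, hFempty] at this
      exact lexLT_irrefl _ this
    · exact (hc3 hn).2 ht F hF hFg (hlex F hFp hFg)
  obtain ⟨C, hlat, hRX, hRg, hold, hnew⟩ := A.blockE_spec hle hc2 hnone
  set c := blockC S s (K.supp g) g (tau g) [] with hc
  set e := blockE s g c.2.1 with he
  have hs : K.supp e.2 = K.supp g := supp_eq_of_gamma_eq hRg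
  have hp' : ∀ h ∈ p ++ [g], h ∈ K.GMF minsupp := by
    intro h hh
    rcases List.mem_append.1 hh with hh | hh
    · exact hp h hh
    · rwa [List.mem_singleton.1 hh]
  have hins : Prince.insertGen S (K.supp g) s g = c.2.2.foldl (blockF S (K.supp e.2) e.2)
      { e.1 with lattice := e.1.lattice ++ c.1.map fun F => (F, e.2) } := by
    rw [hs]
    rfl
  have C' : ClassInv K (p ++ [g])
      { e.1 with lattice := e.1.lattice ++ c.1.map fun F => (F, e.2) } := ⟨C.1, C.2, C.3, C.4⟩
  obtain ⟨hX, hf, hlattice⟩ := C'.foldl_blockF_spec H hminsupp hp'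
    (hp' _ (C.mem_of_mem_X _ hRX))
    (fun h hh hlt => List.mem_append_left _ (hpg h hh (hs ▸ hlt))) c.2.2
    (fun g₁ hg₁ => by
      obtain ⟨h1, h2⟩ := htau g₁ (hv ▸ List.mem_append_right _ hg₁)
      exact ⟨List.mem_append_left _ h1, hRg ▸ h2⟩)
  rw [← hins] at hX hf hlattice
  -- Blocks C and F together record the arcs into `e.2` witnessed by `g`.
  have hvia : ∀ g₁ h, IsPredVia K minsupp s g g₁ h ↔ h ∈ e.1.X ∧ K.gamma g₁ ⊆ K.gamma h ∧
      K.gamma h ∈ K.lowerCover minsupp (K.gamma e.2) := by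
    intro g₁ h
    rw [IsPredVia, hRg]
    refine ⟨fun hh => ⟨hold h hh.1, hh.2⟩, fun hh => ⟨?_, hh.2⟩⟩
    rcases hnew h hh.1 with h1 | ⟨rfl, -⟩
    · exact h1
    · exact absurd rfl hh.2.2.2.1.ne
  have harc : ∀ h R, (h, R) ∈ (Prince.insertGen S (K.supp g) s g).lattice ↔
      (h, R) ∈ s.lattice ∨ e.2 = R ∧ h ∈ e.1.X ∧
        K.gamma h ∈ K.lowerCover minsupp (K.gamma e.2) ∧
        ∃ g₁ ∈ tau g, K.gamma g₁ ⊆ K.gamma h := by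
    intro h R
    rw [hlattice]
    change (h, R) ∈ e.1.lattice ++ _ ∨ _ ↔ _
    rw [List.mem_append, hlat, or_assoc]
    refine or_congr_right ?_
    simp only [List.mem_map, Prod.mk.injEq, hc1, List.not_mem_nil, false_or, hvia]
    constructor
    · rintro (⟨F, ⟨g₁, hg₁, h1, h2, h3⟩, rfl, rfl⟩ | ⟨h0, g₁, hg₁, h1, h2, h3⟩)
      · exact ⟨rfl, h1, h3, g₁, hv ▸ List.mem_append_left _ hg₁, h2⟩
      · exact ⟨h0, h1, h3, g₁, hv ▸ List.mem_append_right _ hg₁, h2⟩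
    · rintro ⟨h0, h1, h3, g₁, hg₁, h2⟩
      rw [hv] at hg₁
      rcases List.mem_append.1 hg₁ with hg₁ | hg₁
      · exact Or.inl ⟨h, ⟨g₁, hg₁, h1, h2, h3⟩, rfl, h0⟩
      · exact Or.inr ⟨h0, g₁, hg₁, h1, h2, h3⟩
  refine ⟨⟨?_, ?_, ?_, ?_⟩, ?_⟩
  · rw [hX]
    exact C.mem_of_mem_X
  · rw [hX]
    exact C.pairwise_X
  · rw [hX]
    exact C.exists_mem_X
  · rw [hX, hf]
    exact C.mem_f
  · intro h R
    rw [harc, A.mem_lattice, hX]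
    constructor
    · rintro (⟨h1, h2, h3, g', hg', h4⟩ | ⟨rfl, h1, h2, h3⟩)
      · exact ⟨hold h h1, hold R h2, h3, g', List.mem_append_left _ hg', h4⟩
      · exact ⟨h1, hRX, h2, g, List.mem_append_right _ (List.mem_singleton_self g), hRg.symm, h3⟩
    · rintro ⟨h1, h2, h3, g', hg', h4, h5⟩
      change h ∈ e.1.X at h1
      change R ∈ e.1.X at h2
      rcases List.mem_append.1 hg' with hg' | hg'
      · have hRs : R ∈ s.X := by
          rcases hnew R h2 with h6 | ⟨hRg', h6⟩
          · exact h6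
          · obtain ⟨F, hF, hFg⟩ := A.exists_mem_X g' hg'
            exact absurd (hFg.trans (h4.trans (by rw [hRg']))) (h6 F hF)
        refine Or.inl ⟨?_, hRs, h3, g', hg', h4, h5⟩
        rcases hnew h h1 with h6 | ⟨rfl, -⟩
        · exact h6
        · exact absurd (supp_lt_of_gamma_ssubset h3.2.1) (hle R (A.mem_of_mem_X R hRs)).not_gt
      · rw [List.mem_singleton.1 hg'] at h4 h5
        obtain rfl : e.2 = R := C.eq_of_gamma_eq hRX h2 (hRg.trans h4)
        exact Or.inr ⟨rfl, h1, h3, h5⟩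

/-- The result of `Gen-Ordre` is the Hasse diagram of the frequent closed patterns, each of them
given by a representative of its class of generators. -/
structure OrdreCorrect (K : Context O I) (minsupp : ℕ) (T : OrdreState I) : Prop where
  mem_GMF : ∀ R ∈ T.X, R ∈ K.GMF minsupp
  exists_mem_X : ∀ g ∈ K.GMF minsupp, ∃ R ∈ T.X, K.gamma R = K.gamma g
  eq_of_gamma_eq : ∀ R ∈ T.X, ∀ R' ∈ T.X, K.gamma R = K.gamma R' → R = R'
  mem_f : ∀ R ∈ T.X, ∀ t, t ∈ T.f R ↔ t ∈ K.GMF minsupp ∧ K.gamma t = K.gamma R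
  mem_succs : ∀ R ∈ T.X, ∀ h, h ∈ T.succs R ↔
    h ∈ T.X ∧ K.gamma R ∈ K.lowerCover minsupp (K.gamma h)

theorem mem_succs {I : Type*} [LinearOrder I] {T : OrdreState I} {g h : Finset I} :
    h ∈ T.succs g ↔ h ∈ T.X ∧ (g, h) ∈ T.lattice := by
  rw [OrdreState.succs, List.mem_filter, decide_eq_true_iff]

theorem ordreCorrect_genOrdre (H : GenCorrect K minsupp S)
    (hminsupp : minsupp ≤ Fintype.card O) : OrdreCorrect K minsupp (genOrdre S) := by
  have hmem : ∀ g, g ∈ treatmentList S ↔ g ∈ K.GMF minsupp := fun g => by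
    rw [mem_treatmentList, H.gmf_eq]
  have A : OrdreInv K minsupp (treatmentList S) (genOrdre S) := by
    rw [genOrdre_eq_foldl]
    refine foldl_induction_prefix (OrdreInv K minsupp) (fun p g q s hl hinv => ?_)
      ⟨⟨by simp, by simp, by simp, by simp⟩, by simp⟩
    have hpw := pairwise_treatmentList S
    rw [hl, List.pairwise_append, List.pairwise_cons] at hpw
    obtain ⟨-, ⟨hgq, -⟩, hpq⟩ := hpw
    have hsub : ∀ h, h ∈ p ++ g :: q → h ∈ K.GMF minsupp := fun h hh => (hmem h).1 (hl ▸ hh)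
    have hp : ∀ h ∈ p, h ∈ K.GMF minsupp := fun h hh => hsub h (List.mem_append_left _ hh)
    have hg : g ∈ K.GMF minsupp := hsub g (List.mem_append_right _ List.mem_cons_self)
    rw [H.support_eq g hg]
    refine hinv.insertGen H hminsupp hp hg (fun h hh hlt => ?_) fun h hh => ?_
    · have hh' := (hmem h).2 hh
      rw [hl, List.mem_append, List.mem_cons] at hh'
      rcases hh' with hh' | rfl | hh'
      · exact hh'
      · exact absurd hlt (lt_irrefl _)
      · have := hgq h hh'
        rw [H.support_eq g hg, H.support_eq h hh] at this
        omega
    · have := hpq h hh g List.mem_cons_self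
      rwa [H.support_eq g hg, H.support_eq h (hp h hh)] at this
  have hX : ∀ R ∈ (genOrdre S).X, R ∈ K.GMF minsupp := fun R hR =>
    (hmem R).1 (A.mem_of_mem_X R hR)
  refine ⟨hX, fun g hg => A.exists_mem_X g ((hmem g).2 hg),
    fun R hR R' hR' => A.eq_of_gamma_eq hR hR', fun R hR t => by rw [A.mem_f R hR, hmem],
    fun R hR h => ?_⟩
  rw [mem_succs, A.mem_lattice]
  constructor
  · rintro ⟨h1, -, -, h2, -⟩
    exact ⟨h1, h2⟩
  · rintro ⟨h1, h2⟩
    have hh := gamma_mem_IFF.2 (Prince.mem_GMF.1 (hX h h1)).2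
    obtain ⟨i, hi, hiR⟩ := Finset.exists_of_ssubset h2.2.1
    obtain ⟨g, hg, hgh, hig, hsub⟩ := exists_generator_of_lowerCover hh h2 hi hiR
    exact ⟨h1, hR, h1, h2, g, (hmem g).2 hg, hgh, g.erase i, mem_tau.2 ⟨i, hig, rfl⟩,
      gamma_subset_gamma_iff.2 hsub⟩

end StepTwo

/-! ### Traversal of the Hasse diagram -/

section StepThree

variable {O I : Type*} [Fintype O] [Fintype I] [LinearOrder I] {K : Context O I} {minsupp : ℕ}
  {minconf : ℝ} {S : GenResult I} {T : OrdreState I} {B : List (Finset I)}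
  {s s' s'' : BGRState I} {E E' : Set (ExactRule I)} {A A' : Set (ApproxRule I)}
  {N N' : Set (Finset I)}

theorem mem_foldl_union {I : Type*} [DecidableEq I] {l : List (Finset I)} {a : Finset I} {i : I} :
    i ∈ l.foldl (fun a t => a ∪ t) a ↔ i ∈ a ∨ ∃ t ∈ l, i ∈ t := by
  induction l generalizing a with
  | nil => simp
  | cons t l ih => rw [List.foldl_cons, ih, Finset.mem_union, List.exists_mem_cons_iff, or_assoc]

/-- The exact rules obtained from the class of `g`. -/
def exactRules (K : Context O I) (T : OrdreState I) (g : Finset I) : Set (ExactRule I) :=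
  {r | K.gamma g ≠ g ∧ ∃ t ∈ T.f g, r = ⟨t, K.gamma g \ t, K.supp g⟩}

/-- The approximate rules obtained from the arc `(g, h)`. -/
def approxRules (K : Context O I) (T : OrdreState I) (minconf : ℝ) (g h : Finset I) :
    Set (ApproxRule I) :=
  {r | minconf ≤ (K.supp h : ℝ) / (K.supp g : ℝ) ∧
    ∃ t ∈ T.f g, r = ⟨t, K.gamma h \ t, K.supp h, (K.supp h : ℝ) / (K.supp g : ℝ)⟩}

/-- The representatives in `L` are those whose field `iff` has been filled in, with the closure. An
empty field marks the others; the empty set, which may be closed, is in `L` from the start. -/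
structure IffInv (K : Context O I) (T : OrdreState I) (L : List (Finset I))
    (iff : Finset I → Finset I) : Prop where
  mem_X : ∀ R ∈ L, R ∈ T.X
  iff_eq : ∀ R ∈ L, iff R = K.gamma R
  iff_eq_empty : ∀ R ∈ T.X, R ∉ L → iff R = ∅
  empty_mem : ∅ ∈ L

/-- A part of the traversal leading from `s` to `s'` outputs exactly the rules in `E` and `A`, and
puts the elements of `N` on the list `L₂` unless they are on it or in `B`. -/
structure Visits (K : Context O I) (T : OrdreState I) (B : List (Finset I))
    (E : Set (ExactRule I)) (A : Set (ApproxRule I)) (N : Set (Finset I)) (s s' : BGRState I) :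
    Prop where
  L₁_eq : s'.L₁ = s.L₁
  subset_L₂ : s.L₂ ⊆ s'.L₂
  mem_L₂ : ∀ x ∈ s'.L₂, x ∈ s.L₂ ∨ x ∈ N
  covered : ∀ x ∈ N, x ∈ B ++ s'.L₂
  iffInv : IffInv K T (B ++ s'.L₂) s'.iff
  mem_BG : ∀ r, r ∈ s'.BG ↔ r ∈ s.BG ∨ r ∈ E
  mem_RI : ∀ r, r ∈ s'.RI ↔ r ∈ s.RI ∨ r ∈ A

theorem Visits.refl (hs : IffInv K T (B ++ s.L₂) s.iff) : Visits K T B ∅ ∅ ∅ s s where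
  L₁_eq := rfl
  subset_L₂ := List.Subset.refl _
  mem_L₂ _ hx := Or.inl hx
  covered _ hx := absurd hx (Set.notMem_empty _)
  iffInv := hs
  mem_BG := by simp
  mem_RI := by simp

theorem Visits.trans (h : Visits K T B E A N s s') (h' : Visits K T B E' A' N' s' s'') :
    Visits K T B (E ∪ E') (A ∪ A') (N ∪ N') s s'' where
  L₁_eq := h'.L₁_eq.trans h.L₁_eq
  subset_L₂ := List.Subset.trans h.subset_L₂ h'.subset_L₂
  mem_L₂ x hx := by
    rcases h'.mem_L₂ x hx with hx | hx
    · exact (h.mem_L₂ x hx).imp_right Or.inl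
    · exact Or.inr (Or.inr hx)
  covered x hx := by
    rcases hx with hx | hx
    · exact (List.mem_append.1 (h.covered x hx)).elim (fun h => List.mem_append_left _ h)
        fun h => List.mem_append_right _ (h'.subset_L₂ h)
    · exact h'.covered x hx
  iffInv := h'.iffInv
  mem_BG r := by rw [h'.mem_BG, h.mem_BG, or_assoc, Set.mem_union]
  mem_RI r := by rw [h'.mem_RI, h.mem_RI, or_assoc, Set.mem_union]

theorem Visits.foldl {f : BGRState I → Finset I → BGRState I} {E : Finset I → Set (ExactRule I)}
    {A : Finset I → Set (ApproxRule I)} {N : Finset I → Set (Finset I)} {l : List (Finset I)}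
    (hf : ∀ x ∈ l, ∀ s, IffInv K T (B ++ s.L₂) s.iff →
      Visits K T B (E x) (A x) (N x) s (f s x)) (hs : IffInv K T (B ++ s.L₂) s.iff) :
    Visits K T B (⋃ x ∈ l, E x) (⋃ x ∈ l, A x) (⋃ x ∈ l, N x) s (l.foldl f s) := by
  induction l generalizing s with
  | nil => simpa using Visits.refl hs
  | cons x l ih =>
    obtain ⟨hx, hl⟩ := List.forall_mem_cons.1 hf
    have h1 := hx s hs
    have h2 := h1.trans (ih hl h1.iffInv)
    simpa only [List.foldl_cons, List.mem_cons, Set.iUnion_iUnion_eq_or_left] using h2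

theorem Visits.visitSucc (H : GenCorrect K minsupp S) (D : OrdreCorrect K minsupp T)
    (hs : IffInv K T (B ++ s.L₂) s.iff) {g g₁ : Finset I} (hg : g ∈ B) (hg₁ : g₁ ∈ T.succs g) :
    Visits K T B ∅ (approxRules K T minconf g g₁) {g₁} s (visitSucc S T minconf g s g₁) := by
  have hgs : g ∈ B ++ s.L₂ := List.mem_append_left _ hg
  have hgX := hs.mem_X g hgs
  have hgγ := hs.iff_eq g hgs
  obtain ⟨hg₁X, hcov⟩ := (D.mem_succs g hgX g₁).1 hg₁
  have hsupp : ∀ R ∈ T.X, S.support R = K.supp R := fun R hR => H.support_eq R (D.mem_GMF R hR)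
  have hne : g₁ ≠ ∅ := by
    rintro rfl
    exact hcov.2.1.not_subset (gamma_mono (Finset.empty_subset g))
  -- The closure of `g₁` is the union of an immediate predecessor and all its minimal generators.
  have hunion : (T.f g₁).foldl (fun a t => a ∪ t) ∅ ∪ s.iff g = K.gamma g₁ := by
    ext i
    rw [Finset.mem_union, mem_foldl_union, hgγ]
    constructor
    · rintro ((hi | ⟨t, ht, hi⟩) | hi)
      · exact absurd hi (Finset.notMem_empty i)
      · rw [← ((D.mem_f g₁ hg₁X t).1 ht).2]
        exact subset_gamma hi
      · exact hcov.2.1.subset hi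
    · intro hi
      by_cases hig : i ∈ K.gamma g
      · exact Or.inr hig
      · obtain ⟨t, ht, htc, hit, -⟩ := exists_generator_of_lowerCover
          (gamma_mem_IFF.2 (mem_GMF.1 (D.mem_GMF g₁ hg₁X)).2) hcov hi hig
        exact Or.inl (Or.inr ⟨t, (D.mem_f g₁ hg₁X t).2 ⟨ht, htc⟩, hit⟩)
  -- The state after the field `iff` of `g₁` has been filled in.
  obtain ⟨s₁, hs₁, hv⟩ : ∃ s₁, s₁ = (if s.iff g₁ = ∅ then
        { s with
          iff := Function.update s.iff g₁ ((T.f g₁).foldl (fun a t => a ∪ t) ∅ ∪ s.iff g)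
          L₂ := s.L₂ ++ [g₁] }
      else s) ∧ Visits K T B ∅ ∅ {g₁} s s₁ := by
    refine ⟨_, rfl, ?_⟩
    split_ifs with h
    · have hmem : g₁ ∉ B ++ s.L₂ := by
        intro hm
        rw [hs.iff_eq g₁ hm] at h
        exact hne (Finset.subset_empty.1 (h ▸ subset_gamma (K := K) (X := g₁)))
      have hself : g₁ ∈ B ++ (s.L₂ ++ [g₁]) := by simp
      rw [hunion]
      refine ⟨rfl, fun x hx => List.mem_append_left _ hx, fun x hx => ?_, fun x hx => ?_,
        ⟨fun R hR => ?_, fun R hR => ?_, fun R hR hRm => ?_, ?_⟩, by simp, by simp⟩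
      · simpa using hx
      · rw [Set.mem_singleton_iff.1 hx]
        exact hself
      · rw [← List.append_assoc, List.mem_append, List.mem_singleton] at hR
        rcases hR with hR | rfl
        exacts [hs.mem_X R hR, hg₁X]
      · rw [← List.append_assoc, List.mem_append, List.mem_singleton] at hR
        rcases hR with hR | rfl
        · have hRg : R ≠ g₁ := fun e => hmem (e ▸ hR)
          exact (Function.update_of_ne hRg _ _).trans (hs.iff_eq R hR)
        · exact Function.update_self _ _ _
      · rw [← List.append_assoc, List.mem_append, List.mem_singleton, not_or] at hRm
        exact (Function.update_of_ne hRm.2 _ _).trans (hs.iff_eq_empty R hR hRm.1)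
      · rw [← List.append_assoc]
        exact List.mem_append_left _ hs.empty_mem
    · refine ⟨rfl, List.Subset.refl _, fun x hx => Or.inl hx, fun x hx => ?_, hs, by simp,
        by simp⟩
      rw [Set.mem_singleton_iff.1 hx]
      by_contra hm
      exact h (hs.iff_eq_empty g₁ hg₁X hm)
  have hiff : s₁.iff g₁ = K.gamma g₁ := hv.iffInv.iff_eq g₁ (hv.covered g₁ rfl)
  have hvisit : Prince.visitSucc S T minconf g s g₁ =
      if minconf ≤ (K.supp g₁ : ℝ) / (K.supp g : ℝ) then
        { s₁ with
          RI := s₁.RI ++ (T.f g).map fun t =>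
            ⟨t, K.gamma g₁ \ t, K.supp g₁, (K.supp g₁ : ℝ) / (K.supp g : ℝ)⟩ }
      else s₁ := by
    rw [← hiff, hs₁, ← hsupp g₁ hg₁X, ← hsupp g hgX]
    rfl
  rw [hvisit]
  split_ifs with h
  · refine ⟨hv.L₁_eq, hv.subset_L₂, hv.mem_L₂, hv.covered, hv.iffInv, hv.mem_BG, fun r => ?_⟩
    change r ∈ s₁.RI ++ _ ↔ _
    rw [List.mem_append, hv.mem_RI, List.mem_map]
    simp only [Set.mem_empty_iff_false, or_false, approxRules, h, true_and, Set.mem_ofPred_eq,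
      eq_comm]
  · refine ⟨hv.L₁_eq, hv.subset_L₂, hv.mem_L₂, hv.covered, hv.iffInv, hv.mem_BG, fun r => ?_⟩
    rw [hv.mem_RI]
    simp only [Set.mem_empty_iff_false, or_false, approxRules, h, false_and, Set.mem_ofPred_eq]

theorem Visits.visitClass (H : GenCorrect K minsupp S) (D : OrdreCorrect K minsupp T)
    (hs : IffInv K T (B ++ s.L₂) s.iff) {g : Finset I} (hg : g ∈ B) :
    Visits K T B (exactRules K T g) (⋃ h ∈ T.succs g, approxRules K T minconf g h)
      {h | h ∈ T.succs g} s (visitClass S T minconf s g) := by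
  have hgs : g ∈ B ++ s.L₂ := List.mem_append_left _ hg
  have hsupp := H.support_eq g (D.mem_GMF g (hs.mem_X g hgs))
  have h1 : Visits K T B (exactRules K T g) ∅ ∅ s (if s.iff g ≠ g then
      { s with BG := s.BG ++ (T.f g).map fun t => ⟨t, s.iff g \ t, S.support g⟩ } else s) := by
    rw [hs.iff_eq g hgs, hsupp]
    split_ifs with h
    · refine ⟨rfl, List.Subset.refl _, fun x hx => Or.inl hx,
        fun x hx => absurd hx (Set.notMem_empty x), hs, fun r => ?_, by simp⟩
      simp only [exactRules, h, List.mem_append, List.mem_map, Set.mem_ofPred_eq, true_and,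
        ne_eq, not_false_eq_true, eq_comm]
    · refine ⟨rfl, List.Subset.refl _, fun x hx => Or.inl hx,
        fun x hx => absurd hx (Set.notMem_empty x), hs, fun r => ?_, by simp⟩
      simp only [exactRules, h, Set.mem_ofPred_eq, false_and, or_false]
  have h2 := h1.trans (Visits.foldl (l := T.succs g) (f := Prince.visitSucc S T minconf g)
    (fun g₁ hg₁ s hs => Visits.visitSucc H D hs hg hg₁) h1.iffInv)
  have hN : (∅ ∪ ⋃ h ∈ T.succs g, {h} : Set (Finset I)) = {h | h ∈ T.succs g} := by
    ext x
    simp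
  have hE : exactRules K T g ∪ ⋃ h ∈ T.succs g, (∅ : Set (ExactRule I)) = exactRules K T g := by
    simp
  rw [hN, hE, Set.empty_union] at h2
  exact h2

/-- The invariant of the main loop of `Gen-BGRs`, the list `V` containing the representatives whose
classes have been treated; `k` is the number of iterations, which bounds the sizes of the closed
patterns still to be treated from below. -/
structure BGRInv (K : Context O I) (T : OrdreState I) (minconf : ℝ) (V : List (Finset I)) (k : ℕ)
    (s : BGRState I) : Prop where
  L₂_eq : s.L₂ = []
  iffInv : IffInv K T (V ++ s.L₁) s.iff
  mem_of_mem_succs : ∀ g ∈ V, ∀ h ∈ T.succs g, h ∈ V ++ s.L₁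
  mem_BG : ∀ r, r ∈ s.BG ↔ ∃ g ∈ V, r ∈ exactRules K T g
  mem_RI : ∀ r, r ∈ s.RI ↔ ∃ g ∈ V, ∃ h ∈ T.succs g, r ∈ approxRules K T minconf g h
  le_card : ∀ g ∈ s.L₁, k ≤ (K.gamma g).card

theorem BGRInv.step (H : GenCorrect K minsupp S) (D : OrdreCorrect K minsupp T)
    {V : List (Finset I)} {k : ℕ} (P : BGRInv K T minconf V k s) :
    BGRInv K T minconf (V ++ s.L₁) (k + 1) (bgrStep S T minconf s) := by
  have hv := Visits.foldl (B := V ++ s.L₁) (l := s.L₁) (f := visitClass S T minconf)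
    (fun g hg s hs => Visits.visitClass H D hs (List.mem_append_right _ hg))
    (s := s) (by rw [P.L₂_eq, List.append_nil]; exact P.iffInv)
  refine ⟨rfl, hv.iffInv, fun g hg h hh => ?_, fun r => ?_, fun r => ?_, fun h hh => ?_⟩
  · rcases List.mem_append.1 hg with hg | hg
    · exact List.mem_append_left _ (P.mem_of_mem_succs g hg h hh)
    · exact hv.covered h (Set.mem_biUnion hg hh)
  · refine (hv.mem_BG r).trans ?_
    simp only [P.mem_BG, Set.mem_iUnion, exists_prop, List.mem_append, or_and_right, exists_or]
  · refine (hv.mem_RI r).trans ?_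
    simp only [P.mem_RI, Set.mem_iUnion, exists_prop, List.mem_append, or_and_right, exists_or]
  · have hh' := hv.mem_L₂ h hh
    rw [P.L₂_eq] at hh'
    obtain hh' | hh' := hh'
    · exact absurd hh' List.not_mem_nil
    · simp only [Set.mem_iUnion, Set.mem_ofPred_eq, exists_prop] at hh'
      obtain ⟨g, hg, hgh⟩ := hh'
      have hgX := P.iffInv.mem_X g (List.mem_append_right _ hg)
      have hlt := ((D.mem_succs g hgX h).1 hgh).2.2.1
      exact (P.le_card g hg).trans_lt (Finset.card_lt_card hlt)

/-- All classes are reachable from that of the empty set. -/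
theorem BGRInv.mem_of_L₁_eq_nil (D : OrdreCorrect K minsupp T) {V : List (Finset I)} {k : ℕ}
    (P : BGRInv K T minconf V k s) (hL₁ : s.L₁ = []) {R : Finset I} (hR : R ∈ T.X) : R ∈ V := by
  have hI := P.iffInv
  have hsucc := P.mem_of_mem_succs
  rw [hL₁, List.append_nil] at hI hsucc
  induction hn : (K.gamma R).card using Nat.strong_induction_on generalizing R with
  | _ n ih =>
    have hs := (Prince.mem_GMF.1 (D.mem_GMF R hR)).2
    by_cases he : K.gamma R = K.gamma ∅
    · rw [D.eq_of_gamma_eq R hR ∅ (hI.mem_X ∅ hI.empty_mem) he]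
      exact hI.empty_mem
    · obtain ⟨f, hf⟩ := exists_mem_lowerCover (gamma_mem_IFF.2 hs) he
      obtain ⟨hfc, hfs⟩ := mem_IFF.1 hf.1
      obtain ⟨g, -, hg, hgf⟩ := exists_mem_GMF_subset f hfs
      obtain ⟨R', hR', hRg⟩ := D.exists_mem_X g hg
      have hRf : K.gamma R' = f := hRg.trans (hgf.trans hfc)
      rw [← hRf] at hf
      exact hsucc R' (ih _ (hn ▸ Finset.card_lt_card hf.2.1) hR' rfl) R
        ((D.mem_succs R' hR' R).2 ⟨hR, hf⟩)

theorem exists_mem_genBGRs (H : GenCorrect K minsupp S) (D : OrdreCorrect K minsupp T)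
    (hminsupp : minsupp ≤ Fintype.card O) (minconf : ℝ) :
    ∃ out ∈ genBGRs S T minconf,
      (∀ f G, (f, G) ∈ out.closed ↔ ∃ R ∈ T.X, f = K.gamma R ∧ G = (T.f R).toFinset) ∧
      (∀ r, r ∈ out.BG ↔ ∃ g ∈ T.X, r ∈ exactRules K T g) ∧
      ∀ r, r ∈ out.RI ↔ ∃ g ∈ T.X, ∃ h ∈ T.succs g, r ∈ approxRules K T minconf g h := by
  have hempty : ∅ ∈ T.X := by
    obtain ⟨R, hR, hRe⟩ := D.exists_mem_X ∅
      (Prince.mem_GMF.2 ⟨isGen_empty, by rwa [supp_empty]⟩)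
    by_cases hRempty : R = ∅
    · rwa [← hRempty]
    · exact absurd hRe.symm ((Prince.mem_GMF.1 (D.mem_GMF R hR)).1 ∅
        (Finset.empty_ssubset.2 (Finset.nonempty_iff_ne_empty.2 hRempty)))
  obtain ⟨s, hs, k, ⟨V, P⟩, hL₁⟩ := exists_mem_whileLoop
    (cond := fun s : BGRState I => decide (s.L₁ ≠ [])) (body := bgrStep S T minconf)
    (fun k s => ∃ V, BGRInv K T minconf V k s) (Fintype.card I + 1)
    (fun k s ⟨V, P⟩ _ => ⟨_, P.step H D⟩)
    (fun k s ⟨V, P⟩ hc => by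
      obtain ⟨g, hg⟩ := List.exists_mem_of_ne_nil _ (of_decide_eq_true hc)
      exact Nat.lt_succ_of_le ((P.le_card g hg).trans (Finset.card_le_univ _)))
    (s := { BG := [], RI := [], L₁ := [∅], L₂ := [],
            iff := Function.update (fun _ => ∅) ∅ S.closureEmpty })
    ⟨[], rfl, ⟨by simpa using hempty, by simp [H.closureEmpty_eq], fun R _ hR => by
      rw [List.nil_append, List.mem_singleton] at hR
      change Function.update (fun _ : Finset I => (∅ : Finset I)) ∅ S.closureEmpty R = ∅
      rw [Function.update_of_ne hR], by simp⟩, by simp, by simp, by simp, by simp⟩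
  have hL₁' : s.L₁ = [] := by simpa using hL₁
  have hI := P.iffInv
  rw [hL₁', List.append_nil] at hI
  have hV : ∀ R, R ∈ V ↔ R ∈ T.X := fun R => ⟨hI.mem_X R, P.mem_of_L₁_eq_nil D hL₁'⟩
  refine ⟨_, Part.mem_map _ hs, fun f G => ?_, fun r => ?_, fun r => ?_⟩
  · simp only [List.mem_map, Prod.mk.injEq]
    refine exists_congr fun R => and_congr_right fun hR => ?_
    rw [hI.iff_eq R ((hV R).2 hR)]
    exact and_congr eq_comm eq_comm
  · simp only [P.mem_BG, hV]
  · simp only [P.mem_RI, hV]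

/-! ### The output and the generic bases -/

theorem OrdreCorrect.exists_rep_of_mem_IFF (D : OrdreCorrect K minsupp T) {f : Finset I}
    (hf : f ∈ K.IFF minsupp) : ∃ R ∈ T.X, K.gamma R = f := by
  obtain ⟨hfc, hfs⟩ := mem_IFF.1 hf
  obtain ⟨g, -, hg, hgf⟩ := exists_mem_GMF_subset f hfs
  obtain ⟨R, hR, hRg⟩ := D.exists_mem_X g hg
  exact ⟨R, hR, hRg.trans (hgf.trans hfc)⟩

theorem OrdreCorrect.gamma_mem_IFF (D : OrdreCorrect K minsupp T) {R : Finset I} (hR : R ∈ T.X) :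
    K.gamma R ∈ K.IFF minsupp :=
  Prince.gamma_mem_IFF.2 (Prince.mem_GMF.1 (D.mem_GMF R hR)).2

theorem OrdreCorrect.mem_f_iff_mem_GM (D : OrdreCorrect K minsupp T) {R : Finset I}
    (hR : R ∈ T.X) {t : Finset I} : t ∈ T.f R ↔ t ∈ K.GM (K.gamma R) := by
  rw [D.mem_f R hR, mem_GM_iff_of_mem_IFF (D.gamma_mem_IFF hR)]

theorem OrdreCorrect.toFinset_f (D : OrdreCorrect K minsupp T) {R : Finset I} (hR : R ∈ T.X) :
    (T.f R).toFinset = K.GM (K.gamma R) := by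
  ext t
  rw [List.mem_toFinset, D.mem_f_iff_mem_GM hR]

theorem OrdreCorrect.exists_exactRules_iff (D : OrdreCorrect K minsupp T) {r : ExactRule I} :
    (∃ g ∈ T.X, r ∈ exactRules K T g) ↔ r ∈ K.BG minsupp := by
  -- A closed minimal generator is the only generator of its class.
  have hclosed : ∀ g t : Finset I, IsGen K g → K.gamma g = g → K.gamma t = K.gamma g → t = g := by
    intro g t hg hgc htg
    by_contra hne
    have htg' : t ⊆ g := by
      rw [← hgc, ← htg]
      exact subset_gamma
    exact hg t (htg'.ssubset_of_ne hne) htg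
  constructor
  · rintro ⟨R, hR, hRne, t, ht, rfl⟩
    have ht' := (D.mem_f_iff_mem_GM hR).1 ht
    refine ⟨_, D.gamma_mem_IFF hR, t, ht', fun hte => hRne ?_, by rw [supp_gamma]⟩
    obtain ⟨htc, htg⟩ := mem_GM.1 ht'
    have htt : K.gamma t = t := by rw [hte, gamma_gamma]
    rw [hclosed t R htg htt (by rw [hte, gamma_gamma]), htt]
  · rintro ⟨f, hf, t, ht, hne, rfl⟩
    obtain ⟨R, hR, rfl⟩ := D.exists_rep_of_mem_IFF hf
    refine ⟨R, hR, fun hRe => hne ?_, t, (D.mem_f_iff_mem_GM hR).2 ht, by rw [supp_gamma]⟩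
    have htR := (D.mem_f R hR t).1 ((D.mem_f_iff_mem_GM hR).2 ht)
    rw [hclosed R t (Prince.mem_GMF.1 (D.mem_GMF R hR)).1 hRe htR.2, hRe]

theorem OrdreCorrect.exists_approxRules_iff (D : OrdreCorrect K minsupp T) {r : ApproxRule I} :
    (∃ g ∈ T.X, ∃ h ∈ T.succs g, r ∈ approxRules K T minconf g h) ↔ r ∈ K.RI minsupp minconf := by
  constructor
  · rintro ⟨g, hg, h, hh, hconf, t, ht, rfl⟩
    obtain ⟨hhX, hcov⟩ := (D.mem_succs g hg h).1 hh
    obtain ⟨htG, htg⟩ := (D.mem_f g hg t).1 ht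
    rw [← supp_eq_of_gamma_eq htg] at hconf ⊢
    exact ⟨_, D.gamma_mem_IFF hhX, t, htG, htg ▸ hcov, by rwa [supp_gamma], by rw [supp_gamma]⟩
  · rintro ⟨f, hf, t, ht, hcov, hconf, rfl⟩
    obtain ⟨g, hg, hgt⟩ := D.exists_mem_X t ht
    obtain ⟨h, hh, rfl⟩ := D.exists_rep_of_mem_IFF hf
    rw [supp_gamma, ← supp_eq_of_gamma_eq hgt] at hconf ⊢
    exact ⟨g, hg, h, (D.mem_succs g hg h).2 ⟨hh, hgt ▸ hcov⟩, hconf, t,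
      (D.mem_f g hg t).2 ⟨ht, hgt.symm⟩, rfl⟩

end StepThree

end Prince

theorem mainTheorem1 {O I : Type*} [Fintype O] [Fintype I] [LinearOrder I]
    (K : Prince.Context O I) (minsupp : ℕ) (minconf : ℝ) (hminsupp : minsupp ≤ Fintype.card O) :
    ∃ out ∈ Prince.prince K minsupp minconf,
      (∀ (f : Finset I) (G : Finset (Finset I)),
        (f, G) ∈ out.closed ↔ f ∈ K.IFF minsupp ∧ G = K.GM f) ∧
      (∀ r : Prince.ExactRule I, r ∈ out.BG ↔ r ∈ K.BG minsupp) ∧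
      (∀ r : Prince.ApproxRule I, r ∈ out.RI ↔ r ∈ K.RI minsupp minconf) := by
  obtain ⟨S, hS, H⟩ := Prince.exists_mem_genGMs (K := K) hminsupp
  have D := Prince.ordreCorrect_genOrdre H hminsupp
  obtain ⟨out, hout, hclosed, hBG, hRI⟩ := Prince.exists_mem_genBGRs H D hminsupp minconf
  refine ⟨out, Part.mem_bind hS hout, fun f G => ?_, fun r => ?_, fun r => ?_⟩
  · rw [hclosed]
    constructor
    · rintro ⟨R, hR, rfl, rfl⟩
      exact ⟨D.gamma_mem_IFF hR, D.toFinset_f hR⟩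
    · rintro ⟨hf, rfl⟩
      obtain ⟨R, hR, rfl⟩ := D.exists_rep_of_mem_IFF hf
      exact ⟨R, hR, rfl, (D.toFinset_f hR).symm⟩
  · rw [hBG, D.exists_exactRules_iff]
  · rw [hRI, D.exists_approxRules_iff]
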